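/- **Setting.** Let $N\in\{2,3\}$, let $\Omega=([-1,1]|_{\{-1;1\}})^N$ be the flat torus (functions on $\mathbb R^N$ with period $2$ in each coordinate), and let $p\in C[0,\infty)\cap C^1(0,\infty)$ with $p(0)=0$ and $p'>0$ on $(0,\infty)$. Put $P(\varrho)=\varrho\int_1^\varrho p(z)z^{-2}\,dz$ (with $P(0)=0$). The barotropic Euler system is $$\partial_t\varrho+\operatorname{div}(\varrho u)=0,\qquad \partial_t(\varrho u)+\operatorname{div}(\varrho u\otimes u)+\nabla p(\varrho)=0 .$$ A *weak solution* on $[0,T]\times\Omega$ is a pair of bounded measurable functions $\varrho\ge 0$, $u$ (with $\varrho_0=\varrho(0,\cdot)>0$ a.e., $u_0=u(0,\cdot)$) such that for every $\tau\in[0,T]$ $$\int_\Omega\big(\varrho(\tau,\cdot)\varphi(\tau,\cdot)-\varrho_0\varphi(0,\cdot)\big)\,dx=\int_0^\tau\!\!\int_\Omega\big(\varrho\,\partial_t\varphi+\varrho u\cdot\nabla\varphi\big)\,dx\,dt$$ for all $\varphi\in C^\infty([0,T]\times\Omega)$, and $$\int_\Omega\big((\varrho u)(\tau,\cdot)\cdot\varphi(\tau,\cdot)-\varrho_0u_0\cdot\varphi(0,\cdot)\big)\,dx=\int_0^\tau\!\!\int_\Omega\big(\varrho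 u\cdot\partial_t\varphi+\varrho u\otimes u:\nabla\varphi+p(\varrho)\operatorname{div}\varphi\big)\,dx\,dt$$ for all $\varphi\in C^\infty([0,T]\times\Omega;\mathbb R^N)$. Thus $\varrho(\tau,\cdot)$ and $(\varrho u)(\tau,\cdot)$ are well defined a.e. in $\Omega$ for every $\tau$. It is *admissible* if, with $e=\tfrac12\varrho|u|^2+P(\varrho)$, $$\int_0^T\!\!\int_\Omega\big(e\,\partial_t\varphi+e\,u\cdot\nabla\varphi+p(\varrho)u\cdot\nabla\varphi\big)\,dx\,dt+\int_\Omega\big(\tfrac12\varrho_0|u_0|^2+P(\varrho_0)\big)\varphi(0,\cdot)\,dx\ge0$$ for all $0\le\varphi\in C_c^\infty([0,T)\times\Omega)$. Write $\int_\Omega E(\tau+)=\operatorname{ess\,lim}_{t\to\tau+}\int_\Omega e(t,\cdot)\,dx$, which exists for admissible solutions. An admissible solution $[\varrho,u]$ on $[0,T]$ *satisfies the principle of maximal dissipation* if, for every $\tau\in[0,T)$, every $T'\in(\tau,T]$ and every weak solution $[\varrho',u']$ on $[0,T']$ whose energy limits $\int_\Omega E'(t+)$ exist for $t\in(\tau,T')$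 and which satisfies $\varrho'=\varrho$, $\varrho'u'=\varrho u$ in $[0,\tau]\times\Omega$, there are $\tau_n\in(\tau,T')$, $\tau_n\to\tau$, with $\int_\Omega E'(\tau_n+)\ge\int_\Omega E(\tau_n+)$ for all $n$. A *smooth solution* on $[\tau_1,\tau_2]$ is a pair $[\tilde\varrho,\tilde u]$ of class $C^1([\tau_1,\tau_2]\times\Omega)$ with $\tilde\varrho>0$ that satisfies the system pointwise and along which the flux is regular: $p'$ is Lipschitz in a neighbourhood of each value of $\tilde\varrho$ (automatic if $p\in C^2(0,\infty)$). **Proposition 5.1.** Let $[\varrho,u]$ be an admissible weak solution on $[0,T]\times\Omega$ satisfying the principle of maximal dissipation. Let $0\le\tau_1<\tau_2\le T$ and let $[\tilde\varrho,\tilde u]$ be a smooth solution on $[\tau_1,\tau_2]$ with $$\varrho(\tau_1,\cdot)=\tilde\varrho(\tau_1,\cdot),\qquad u(\tau_1,\cdot)=\tilde u(\tau_1,\cdot)\quad\text{a.e. in }\Omega .$$ Then for every $t\in[\tau_1,\tau_2]$ $$\varrho(t,\cdot)=\tilde\varrho(t,\cdot),\qquad u(t,\cdot)=\tilde u(t,\cdot)\quad\text{a.e.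 in }\Omega .$$ -/

import Mathlib

open Set Filter Topology MeasureTheory
open scoped ContDiff RealInnerProductSpace

namespace BarotropicEuler

noncomputable section

/-- Physical space `ℝ^N` with the Euclidean norm. -/
abbrev Space (N : ℕ) : Type := EuclideanSpace ℝ (Fin N)

/-- The `j`-th unit vector. -/
def unitVec {N : ℕ} (j : Fin N) : Space N := EuclideanSpace.single j (1 : ℝ)

/-- The fundamental cell `[-1,1]^N` of the flat torus `Ω`.  Functions on `Ω` that are only
determined almost everywhere are represented by functions on this cell; functions on `Ω` that are
differentiated are represented by functions on `ℝ^N` with period `2` in every coordinate. -/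
def cell (N : ℕ) : Set (Space N) := {x | ∀ i, x i ∈ Icc (-1 : ℝ) 1}

/-- Lebesgue measure on the fundamental cell. -/
def cellMeasure (N : ℕ) : Measure (Space N) := volume.restrict (cell N)

/-- Periodicity with period `2` in each coordinate. -/
def IsPeriodic {N : ℕ} {F : Type*} (f : Space N → F) : Prop :=
  ∀ (i : Fin N) (x : Space N), f (x + (2 : ℝ) • unitVec i) = f x

/-- The divergence `∑ⱼ ∂ⱼ vⱼ` of a vector field. -/
def divergence {N : ℕ} (v : Space N → Space N) (x : Space N) : ℝ :=
  ∑ j, (fderiv ℝ v x (unitVec j)) j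

/-- `div (ρ u ⊗ u) = ∑ⱼ ∂ⱼ (ρ uⱼ u)`. -/
def momentumFluxDiv {N : ℕ} (ρ : Space N → ℝ) (u : Space N → Space N) (x : Space N) : Space N :=
  ∑ j, fderiv ℝ (fun y => (ρ y * u y j) • u y) x (unitVec j)

/-- The hypotheses on the pressure:
`p ∈ C[0,∞) ∩ C¹(0,∞)`, `p 0 = 0`, `p' > 0` on `(0,∞)`. -/
structure IsPressure (p : ℝ → ℝ) : Prop where
  continuousOn : ContinuousOn p (Ici 0)
  contDiffOn : ContDiffOn ℝ 1 p (Ioi 0)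
  map_zero : p 0 = 0
  deriv_pos : ∀ z : ℝ, 0 < z → 0 < deriv p z

/-- The pressure potential `P ρ = ρ ∫₁^ρ p(z)/z² dz`.  At `ρ = 0` this is `0`, which is also the
limit of `P ρ` as `ρ → 0+`, since `p 0 = 0`. -/
def pressurePotential (p : ℝ → ℝ) (ρ : ℝ) : ℝ := ρ * ∫ z in (1 : ℝ)..ρ, p z / z ^ 2

/-- The mechanical energy density `½ ρ |u|² + P(ρ)`. -/
def energyDensity {N : ℕ} (p : ℝ → ℝ) (ρ : ℝ) (u : Space N) : ℝ :=
  1 / 2 * ρ * ‖u‖ ^ 2 + pressurePotential p ρ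

/-- The total mechanical energy at time `t`. -/
def totalEnergy {N : ℕ} (p : ℝ → ℝ) (ρ : ℝ → Space N → ℝ) (u : ℝ → Space N → Space N)
    (t : ℝ) : ℝ :=
  ∫ x, energyDensity p (ρ t x) (u t x) ∂(cellMeasure N)

/-- Test functions: restrictions to the time interval at hand of functions that are smooth on
`ℝ × ℝ^N` and periodic in space. -/
structure IsTest {N : ℕ} {F : Type*} [NormedAddCommGroup F] [NormedSpace ℝ F]
    (φ : ℝ → Space N → F) : Prop where
  smooth : ContDiff ℝ ∞ (Function.uncurry φ)
  periodic : ∀ t, IsPeriodic (φ t)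

/-- `[ρ, u]` is a weak solution of the barotropic Euler system on `[0,T] × Ω` with the initial
data `ρ 0`, `u 0`, where `ρ 0 > 0`.  It is bounded and measurable and the density is nonnegative.
Since both equations are required at every time `τ ∈ [0,T]`, the slices `ρ τ` and `ρ τ • u τ` are
the instantaneous values of the weakly continuous density and momentum. -/
structure IsWeakSolution {N : ℕ} (p : ℝ → ℝ) (T : ℝ) (ρ : ℝ → Space N → ℝ)
    (u : ℝ → Space N → Space N) : Prop where
  measurable_density : Measurable (Function.uncurry ρ)
  measurable_velocity : Measurable (Function.uncurry u)
  bounded : ∃ C : ℝ, ∀ t ∈ Icc 0 T, ∀ᵐ x ∂(cellMeasure N),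
    0 ≤ ρ t x ∧ ρ t x ≤ C ∧ ‖u t x‖ ≤ C
  initial_pos : ∀ᵐ x ∂(cellMeasure N), 0 < ρ 0 x
  continuity : ∀ φ : ℝ → Space N → ℝ, IsTest φ → ∀ τ ∈ Icc 0 T,
    ∫ x, (ρ τ x * φ τ x - ρ 0 x * φ 0 x) ∂(cellMeasure N) =
      ∫ t in (0 : ℝ)..τ, ∫ x, (ρ t x * deriv (fun s => φ s x) t
        + ρ t x * fderiv ℝ (φ t) x (u t x)) ∂(cellMeasure N)
  momentum : ∀ φ : ℝ → Space N → Space N, IsTest φ → ∀ τ ∈ Icc 0 T,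
    ∫ x, (⟪ρ τ x • u τ x, φ τ x⟫ - ⟪ρ 0 x • u 0 x, φ 0 x⟫) ∂(cellMeasure N) =
      ∫ t in (0 : ℝ)..τ, ∫ x, (⟪ρ t x • u t x, deriv (fun s => φ s x) t⟫
        + ρ t x * ⟪u t x, fderiv ℝ (φ t) x (u t x)⟫
        + p (ρ t x) * divergence (φ t) x) ∂(cellMeasure N)

/-- An admissible weak solution: a weak solution that satisfies the weak form of the energy
inequality, tested with nonnegative smooth functions of compact support in `[0,T) × Ω`. -/
structure IsAdmissible {N : ℕ} (p : ℝ → ℝ) (T : ℝ) (ρ : ℝ → Space N → ℝ)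
    (u : ℝ → Space N → Space N) : Prop where
  weak : IsWeakSolution p T ρ u
  energy_inequality : ∀ φ : ℝ → Space N → ℝ, IsTest φ →
    (∀ t ∈ Icc 0 T, ∀ x, 0 ≤ φ t x) → (∃ T' < T, ∀ t, T' ≤ t → ∀ x, φ t x = 0) →
    0 ≤ (∫ t in (0 : ℝ)..T, ∫ x, (energyDensity p (ρ t x) (u t x) * deriv (fun s => φ s x) t
          + energyDensity p (ρ t x) (u t x) * fderiv ℝ (φ t) x (u t x)
          + p (ρ t x) * fderiv ℝ (φ t) x (u t x)) ∂(cellMeasure N))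
        + ∫ x, energyDensity p (ρ 0 x) (u 0 x) * φ 0 x ∂(cellMeasure N)

/-- `e = ∫_Ω E(τ+)`, that is, `e` is the essential limit of the total energy at `t` as
`t → τ+`. -/
def IsRightEnergy {N : ℕ} (p : ℝ → ℝ) (ρ : ℝ → Space N → ℝ) (u : ℝ → Space N → Space N)
    (τ e : ℝ) : Prop :=
  Tendsto (totalEnergy p ρ u) (𝓝[>] τ ⊓ ae volume) (𝓝 e)

/-- The principle of maximal dissipation on `[0,T]`.  A competitor is a weak solution `[ρ', u']`
on `[0,T']` that has the same density and momentum up to time `τ`, and whose energy `E'(t+)`,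
which enters the principle, exists for `t ∈ (τ,T')`; it need not be admissible. -/
def MaximalDissipation {N : ℕ} (p : ℝ → ℝ) (T : ℝ) (ρ : ℝ → Space N → ℝ)
    (u : ℝ → Space N → Space N) : Prop :=
  ∀ (τ T' : ℝ) (ρ' : ℝ → Space N → ℝ) (u' : ℝ → Space N → Space N),
    0 ≤ τ → τ < T' → T' ≤ T → IsWeakSolution p T' ρ' u' →
    (∀ t ∈ Icc 0 τ, ∀ᵐ x ∂(cellMeasure N),
      ρ t x = ρ' t x ∧ ρ t x • u t x = ρ' t x • u' t x) →
    (∀ t ∈ Ioo τ T', ∃ e', IsRightEnergy p ρ' u' t e') →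
    ∃ σ : ℕ → ℝ, (∀ n, σ n ∈ Ioo τ T') ∧ Tendsto σ atTop (𝓝 τ) ∧
      ∀ n, ∃ e e', IsRightEnergy p ρ u (σ n) e ∧ IsRightEnergy p ρ' u' (σ n) e' ∧ e ≤ e'

/-- `[r, U]` is a smooth solution of the Euler system on `[τ₁,τ₂] × Ω`: it is continuously
differentiable up to the end times, the density is positive, the equations hold pointwise, and the
flux is regular along the solution in the sense that `p'` is Lipschitz near every value
of `r` (which holds for every solution if `p` is twice continuously differentiable
on `(0,∞)`). -/
structure IsSmoothSolution {N : ℕ} (p : ℝ → ℝ) (τ₁ τ₂ : ℝ) (r : ℝ → Space N → ℝ)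
    (U : ℝ → Space N → Space N) : Prop where
  contDiffOn_density : ContDiffOn ℝ 1 (Function.uncurry r) (Icc τ₁ τ₂ ×ˢ univ)
  contDiffOn_velocity : ContDiffOn ℝ 1 (Function.uncurry U) (Icc τ₁ τ₂ ×ˢ univ)
  periodic_density : ∀ t ∈ Icc τ₁ τ₂, IsPeriodic (r t)
  periodic_velocity : ∀ t ∈ Icc τ₁ τ₂, IsPeriodic (U t)
  density_pos : ∀ t ∈ Icc τ₁ τ₂, ∀ x, 0 < r t x
  flux_regular : ∀ t ∈ Icc τ₁ τ₂, ∀ x, ∃ K, ∃ s ∈ 𝓝 (r t x), LipschitzOnWith K (deriv p) s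
  continuity : ∀ t ∈ Ioo τ₁ τ₂, ∀ x,
    deriv (fun s => r s x) t + divergence (fun y => r t y • U t y) x = 0
  momentum : ∀ t ∈ Ioo τ₁ τ₂, ∀ x,
    deriv (fun s => r s x • U s x) t + momentumFluxDiv (r t) (U t) x
      + gradient (fun y => p (r t y)) x = 0

end

end BarotropicEuler

open BarotropicEuler

/-!
Let the competitor follow `[ρ, u]` up to time `τ₁` and the smooth solution afterwards. Its energy is
continuous on the right of `τ₁`, so maximal dissipation keeps the energy of `[ρ, u]` from jumping up
at `τ₁`, and by admissibility `E(t) ≤ E(r, U)(τ₁)` for almost every later `t`. This is all that the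
relative energy method needs: testing the continuity equation with `½|U|² - P'(r)` and the momentum
equation with `U` bounds the relative energy of `[ρ, u]` with respect to `[r, U]` by a multiple of
its own time integral, since near each value of `r` the regularity of `p'` dominates
`p(ρ) - p(r) - p'(r)(ρ - r)` by `P(ρ) - P(r) - P'(r)(ρ - r)`. Hence the solutions agree at almost
every time, and weak continuity in time extends this to every time.
-/

namespace BarotropicEuler

/-! ### Mollification -/

section Mollification

open Metric
open scoped Convolution

variable {E : Type*} [NormedAddCommGroup E]

variable (E) in
/-- Bump functions at the origin whose supports shrink to a point at a fixed rate. -/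
noncomputable def shrinkingBump (n : ℕ) : ContDiffBump (0 : E) where
  rIn := 1 / (2 * (n + 1))
  rOut := 1 / (n + 1)
  rIn_pos := by positivity
  rIn_lt_rOut := by
    have : (0 : ℝ) < n + 1 := by positivity
    exact one_div_lt_one_div_of_lt this (by linarith)

lemma shrinkingBump_rOut_tendsto : Tendsto (fun n => (shrinkingBump E n).rOut) atTop (𝓝 0) :=
  tendsto_one_div_add_atTop_nhds_zero_nat

lemma shrinkingBump_rOut_le_one (n : ℕ) : (shrinkingBump E n).rOut ≤ 1 :=
  (div_le_one (by positivity)).2 (by simp)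

lemma shrinkingBump_rOut_le (n : ℕ) : (shrinkingBump E n).rOut ≤ 2 * (shrinkingBump E n).rIn := by
  change 1 / ((n : ℝ) + 1) ≤ 2 * (1 / (2 * (n + 1)))
  apply le_of_eq
  field_simp

variable [NormedSpace ℝ E] [FiniteDimensional ℝ E] [MeasurableSpace E] {μ : Measure E}
  {F : Type*} [NormedAddCommGroup F] [NormedSpace ℝ F] {f : E → F} {n : ℕ}

variable (μ) in
/-- The convolution of `f` with the `n`-th normalized bump function. -/
noncomputable def mollify (n : ℕ) (f : E → F) : E → F :=
  (shrinkingBump E n).normed μ ⋆[ContinuousLinearMap.lsmul ℝ ℝ, μ] f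

lemma mollify_apply (x : E) :
    mollify μ n f x = ∫ y, (shrinkingBump E n).normed μ y • f (x - y) ∂μ := rfl

lemma mollify_add_period {c : E} (hf : ∀ x, f (x + c) = f x) (x : E) :
    mollify μ n f (x + c) = mollify μ n f x := by
  simp only [mollify_apply, add_sub_right_comm, hf]

variable [BorelSpace E] [μ.IsAddHaarMeasure]

lemma integrable_normed_smul_comp_sub (hf : LocallyIntegrable f μ) (x : E) :
    Integrable (fun y => (shrinkingBump E n).normed μ y • f (x - y)) μ :=
  (shrinkingBump E n).hasCompactSupport_normed.convolutionExists_left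
    (ContinuousLinearMap.lsmul ℝ ℝ) (shrinkingBump E n).continuous_normed hf x

lemma contDiff_mollify (hf : LocallyIntegrable f μ) : ContDiff ℝ ∞ (mollify μ n f) :=
  (shrinkingBump E n).hasCompactSupport_normed.contDiff_convolution_left _
    (shrinkingBump E n).contDiff_normed hf

lemma norm_integral_normed_smul_le {h : E → F} {C : ℝ}
    (hC : ∀ y, ‖y‖ < (shrinkingBump E n).rOut → ‖h y‖ ≤ C) :
    ‖∫ y, (shrinkingBump E n).normed μ y • h y ∂μ‖ ≤ C := by
  calc ‖∫ y, (shrinkingBump E n).normed μ y • h y ∂μ‖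
      ≤ ∫ y, (shrinkingBump E n).normed μ y * C ∂μ := by
        refine norm_integral_le_of_norm_le
          ((shrinkingBump E n).integrable_normed.mul_const C) (ae_of_all _ fun y => ?_)
        have h0 := (shrinkingBump E n).nonneg_normed (μ := μ) y
        rw [norm_smul, Real.norm_of_nonneg h0]
        by_cases hy : ‖y‖ < (shrinkingBump E n).rOut
        · exact mul_le_mul_of_nonneg_left (hC y hy) h0
        · have : (shrinkingBump E n).normed μ y = 0 := by
            rw [← Function.notMem_support, ContDiffBump.support_normed_eq]
            simpa using hy
          simp [this]
    _ = C := by rw [integral_mul_const, ContDiffBump.integral_normed, one_mul]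

lemma norm_mollify_le {C : ℝ} {x : E} (hC : ∀ y ∈ ball x 1, ‖f y‖ ≤ C) :
    ‖mollify μ n f x‖ ≤ C :=
  norm_integral_normed_smul_le fun y hy =>
    hC _ (by simpa using hy.trans_le (shrinkingBump_rOut_le_one n))

variable [CompleteSpace F]

lemma mollify_tendsto (hf : Continuous f) (x : E) :
    Tendsto (fun n => mollify μ n f x) atTop (𝓝 (f x)) :=
  ContDiffBump.convolution_tendsto_right_of_continuous shrinkingBump_rOut_tendsto hf x

lemma ae_mollify_tendsto (hf : LocallyIntegrable f μ) :
    ∀ᵐ x ∂μ, Tendsto (fun n => mollify μ n f x) atTop (𝓝 (f x)) :=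
  ContDiffBump.ae_convolution_tendsto_right_of_locallyIntegrable shrinkingBump_rOut_tendsto
    (.of_forall shrinkingBump_rOut_le) hf

variable {A : E →L[ℝ] F} {c : NNReal} {s t : Set E} {x : E}

lemma approximatesLinearOn_mollify (hf : LocallyIntegrable f μ)
    (hA : ApproximatesLinearOn f A s c) (hts : ∀ x ∈ t, ball x (shrinkingBump E n).rOut ⊆ s) :
    ApproximatesLinearOn (mollify μ n f) A t c := by
  intro x hx y hy
  have hconst : A (x - y) = ∫ z, (shrinkingBump E n).normed μ z • A (x - y) ∂μ := by
    rw [integral_smul_const, ContDiffBump.integral_normed, one_smul]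
  have hi : Integrable (fun z => (shrinkingBump E n).normed μ z • A (x - y)) μ :=
    (shrinkingBump E n).integrable_normed.smul_const _
  have hix := integrable_normed_smul_comp_sub (n := n) hf x
  have hiy := integrable_normed_smul_comp_sub (n := n) hf y
  have hixy : Integrable (fun z => (shrinkingBump E n).normed μ z • f (x - z)
      - (shrinkingBump E n).normed μ z • f (y - z)) μ := hix.sub hiy
  have hsub : mollify μ n f x - mollify μ n f y - A (x - y) = ∫ z,
      (shrinkingBump E n).normed μ z • (f (x - z) - f (y - z) - A (x - z - (y - z))) ∂μ := by
    rw [hconst, mollify_apply, mollify_apply, ← integral_sub hix hiy, ← integral_sub hixy hi]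
    simp only [smul_sub, sub_sub_sub_cancel_right]
  rw [hsub]
  refine norm_integral_normed_smul_le fun z hz => ?_
  simpa only [sub_sub_sub_cancel_right] using
    hA (x - z) (hts x hx (by simpa using hz)) (y - z) (hts y hy (by simpa using hz))

lemma norm_fderiv_mollify_sub_le (hf : LocallyIntegrable f μ) (hA : ApproximatesLinearOn f A s c)
    {δ : ℝ} (hδ : (shrinkingBump E n).rOut < δ) (hs : ball x δ ⊆ s) :
    ‖fderiv ℝ (mollify μ n f) x - A‖ ≤ c := by
  have happ : ApproximatesLinearOn (mollify μ n f) A (ball x (δ - (shrinkingBump E n).rOut)) c :=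
    approximatesLinearOn_mollify hf hA fun y hy =>
      (ball_subset_ball' (by linarith [mem_ball.1 hy])).trans hs
  have hd : HasFDerivAt (mollify μ n f - ⇑A) (fderiv ℝ (mollify μ n f) x - A) x :=
    (((contDiff_mollify hf).differentiable (by simp)) x).hasFDerivAt.sub A.hasFDerivAt
  exact hd.le_of_lipschitzOn (ball_mem_nhds x (sub_pos.2 hδ)) happ.lipschitzOnWith

lemma fderiv_mollify_tendsto (hf : LocallyIntegrable f μ) (hA : HasStrictFDerivAt f A x) :
    Tendsto (fun n => fderiv ℝ (mollify μ n f) x) atTop (𝓝 A) := by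
  rw [Metric.tendsto_atTop']
  intro ε hε
  obtain ⟨s, hs, happ⟩ := hA.approximates_deriv_on_nhds (c := ⟨ε / 2, by positivity⟩)
    (Or.inr (NNReal.coe_pos.1 (half_pos hε)))
  obtain ⟨δ, hδ, hball⟩ := Metric.mem_nhds_iff.1 hs
  obtain ⟨m, hm⟩ := eventually_atTop.1
    ((shrinkingBump_rOut_tendsto (E := E)).eventually (gt_mem_nhds hδ))
  refine ⟨m, fun n hn => ?_⟩
  rw [dist_eq_norm]
  exact (norm_fderiv_mollify_sub_le hf happ (hm n hn.le) hball).trans_lt (half_lt_self hε)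

end Mollification

/-! ### The periodic cell -/

section Cell

variable {N : ℕ}

lemma cell_eq_preimage (N : ℕ) :
    cell N = WithLp.ofLp ⁻¹' (Icc (fun _ => -1) (fun _ => 1) : Set (Fin N → ℝ)) := by
  ext x
  simp [cell, Pi.le_def, forall_and]

lemma isCompact_cell (N : ℕ) : IsCompact (cell N) := by
  rw [cell_eq_preimage]
  exact (PiLp.homeomorph 2 (fun _ : Fin N => ℝ)).isCompact_preimage.2 isCompact_Icc

lemma measurableSet_cell (N : ℕ) : MeasurableSet (cell N) :=
  (isCompact_cell N).isClosed.measurableSet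

instance isFiniteMeasure_cellMeasure (N : ℕ) : IsFiniteMeasure (cellMeasure N) :=
  isFiniteMeasure_restrict.2 (isCompact_cell N).measure_lt_top.ne

lemma ae_mem_cell (N : ℕ) : ∀ᵐ x ∂(cellMeasure N), x ∈ cell N :=
  ae_restrict_mem (measurableSet_cell N)

lemma exists_cell_subset_ball (N : ℕ) : ∃ R, cell N ⊆ Metric.ball 0 R :=
  ((isCompact_cell N).isBounded.subset_ball_lt 0 0).imp fun _ h => h.2

lemma measurePreserving_ofLp_cell (N : ℕ) :
    MeasurePreserving (WithLp.ofLp : Space N → Fin N → ℝ) (cellMeasure N)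
      (volume.restrict (Icc (fun _ => -1) (fun _ => 1))) := by
  rw [cellMeasure, cell_eq_preimage]
  exact (PiLp.volume_preserving_ofLp (Fin N)).restrict_preimage_emb
    (MeasurableEquiv.toLp 2 (Fin N → ℝ)).symm.measurableEmbedding _

lemma toLp_insertNth_one {n : ℕ} (j : Fin (n + 1)) (y : Fin n → ℝ) :
    (WithLp.toLp 2 (j.insertNth 1 y) : Space (n + 1))
      = WithLp.toLp 2 (j.insertNth (-1) y) + (2 : ℝ) • unitVec j := by
  ext k
  rcases Fin.eq_self_or_eq_succAbove j k with rfl | ⟨l, rfl⟩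
  · norm_num [unitVec]
  · simp [unitVec, Fin.succAbove_ne]

lemma integral_fderiv_unitVec_eq_zero {F : Type*} [NormedAddCommGroup F] [NormedSpace ℝ F]
    {w : Space N → F} (hw : Differentiable ℝ w) (hper : IsPeriodic w) (j : Fin N)
    (hint : Integrable (fun x => fderiv ℝ w x (unitVec j)) (cellMeasure N)) :
    ∫ x, fderiv ℝ w x (unitVec j) ∂(cellMeasure N) = 0 := by
  obtain _ | n := N
  · exact j.elim0
  let Λ := (PiLp.continuousLinearEquiv 2 ℝ fun _ : Fin (n + 1) => ℝ).symm
  have hemb := (MeasurableEquiv.toLp 2 (Fin (n + 1) → ℝ)).symm.measurableEmbedding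
  let f : Fin (n + 1) → (Fin (n + 1) → ℝ) → F := Pi.single j fun y => w (Λ y)
  let f' : Fin (n + 1) → (Fin (n + 1) → ℝ) → (Fin (n + 1) → ℝ) →L[ℝ] F :=
    Pi.single j fun y => (fderiv ℝ w (Λ y)).comp (Λ : _ →L[ℝ] _)
  have hf : ∀ y i, HasFDerivAt (f i) (f' i y) y := by
    intro y i
    by_cases h : i = j
    · subst h
      simp only [f, f', Pi.single_eq_same]
      exact (hw (Λ y)).hasFDerivAt.comp y Λ.hasFDerivAt
    · simp only [f, f', Pi.single_eq_of_ne h]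
      exact hasFDerivAt_const 0 y
  have hsum : ∀ y, ∑ i, f' i y (Pi.single i 1) = fderiv ℝ w (Λ y) (unitVec j) := by
    intro y
    rw [Finset.sum_eq_single j (fun i _ h => by simp [f', Pi.single_eq_of_ne h]) (by simp)]
    simp only [f', Pi.single_eq_same]
    rfl
  have key := integral_divergence_of_hasFDerivAt_off_countable' (fun _ => -1) (fun _ => 1)
    (fun _ => by norm_num) f f' ∅ countable_empty
    (fun i y _ => (hf y i).continuousAt.continuousWithinAt) (fun y _ => hf y) <| by
      simp only [hsum]
      exact ((measurePreserving_ofLp_cell (n + 1)).integrable_comp_emb hemb).1 hint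
  simp only [hsum] at key
  refine ((measurePreserving_ofLp_cell (n + 1)).integral_comp hemb
    fun y => fderiv ℝ w (Λ y) (unitVec j)).trans (key.trans ?_)
  refine Finset.sum_eq_zero fun i _ => sub_eq_zero.2 ?_
  congr 1 with y
  by_cases h : i = j
  · subst h
    simp only [f, Pi.single_eq_same]
    exact (congrArg w (toLp_insertNth_one i y)).trans (hper i _)
  · simp only [f, Pi.single_eq_of_ne h, Pi.zero_apply]

lemma integrable_cell_of_bound {F : Type*} [NormedAddCommGroup F] {f : Space N → F}
    (hf : AEStronglyMeasurable f (cellMeasure N)) {C : ℝ} (hC : ∀ x ∈ cell N, ‖f x‖ ≤ C) :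
    Integrable f (cellMeasure N) :=
  Integrable.of_bound hf C ((ae_mem_cell N).mono hC)

end Cell

section SpaceTimeMeasure

variable {N : ℕ} {a b : ℝ}

instance isAddHaarMeasure_spaceTime (N : ℕ) :
    (volume : Measure (ℝ × Space N)).IsAddHaarMeasure :=
  inferInstanceAs (((volume : Measure ℝ).prod (volume : Measure (Space N))).IsAddHaarMeasure)

/-- The measure `dt dx` on `(a,b] × Ω`. -/
noncomputable def stMeasure (N : ℕ) (a b : ℝ) : Measure (ℝ × Space N) :=
  (volume.restrict (Ioc a b)).prod (cellMeasure N)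

instance isFiniteMeasure_stMeasure (N : ℕ) (a b : ℝ) : IsFiniteMeasure (stMeasure N a b) := by
  unfold stMeasure
  infer_instance

lemma ae_mem_Ioo (a b : ℝ) : ∀ᵐ t ∂(volume.restrict (Ioc a b)), t ∈ Ioo a b := by
  rw [← restrict_Ioo_eq_restrict_Ioc]
  exact ae_restrict_mem measurableSet_Ioo

lemma ae_stMeasure_mem (a b : ℝ) :
    ∀ᵐ z ∂(stMeasure N a b), z.1 ∈ Ioo a b ∧ z.2 ∈ cell N :=
  (Measure.quasiMeasurePreserving_fst.ae (ae_mem_Ioo a b)).and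
    (Measure.quasiMeasurePreserving_snd.ae (ae_mem_cell N))

lemma ae_stMeasure_of_ae_ae {P : ℝ × Space N → Prop} (hP : MeasurableSet {z | P z})
    (h : ∀ᵐ t, t ∈ Ioo a b → ∀ᵐ x ∂(cellMeasure N), P (t, x)) :
    ∀ᵐ z ∂(stMeasure N a b), P z := by
  refine (Measure.ae_prod_iff_ae_ae hP).2 ?_
  filter_upwards [ae_restrict_of_ae h, ae_mem_Ioo a b] with t ht hmem using ht hmem

lemma integrable_stMeasure_of_bound {F : Type*} [NormedAddCommGroup F] {f : ℝ × Space N → F}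
    (hf : AEStronglyMeasurable f (stMeasure N a b)) {C : ℝ}
    (hC : ∀ t ∈ Ioo a b, ∀ x ∈ cell N, ‖f (t, x)‖ ≤ C) : Integrable f (stMeasure N a b) :=
  Integrable.of_bound hf C ((ae_stMeasure_mem a b).mono fun z hz => hC z.1 hz.1 z.2 hz.2)

lemma intervalIntegral_eq_stMeasure (hab : a ≤ b) {f : ℝ → Space N → ℝ}
    (hf : Integrable (Function.uncurry f) (stMeasure N a b)) :
    ∫ t in a..b, ∫ x, f t x ∂(cellMeasure N) = ∫ z, f z.1 z.2 ∂(stMeasure N a b) := by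
  rw [intervalIntegral.integral_of_le hab]
  exact (integral_prod (Function.uncurry f) hf).symm

lemma measurable_slice {α : Type*} [MeasurableSpace α] {f : ℝ → Space N → α}
    (hf : Measurable (Function.uncurry f)) (t : ℝ) : Measurable (f t) :=
  hf.comp measurable_prodMk_left

end SpaceTimeMeasure

/-! ### Space-time derivatives and functions of class `C¹` on the torus -/

section SpaceTimeDerivative

variable {N : ℕ} {F : Type*} [NormedAddCommGroup F] [NormedSpace ℝ F]

/-- The space-time derivative of `φ` at `(t, x)`; the vectors `(1, 0)` and `(0, v)` give the time
derivative and the spatial derivative in the direction `v`. -/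
noncomputable def stDeriv (φ : ℝ → Space N → F) (t : ℝ) (x : Space N) : ℝ × Space N →L[ℝ] F :=
  fderiv ℝ (Function.uncurry φ) (t, x)

/-- The spatial divergence `∑ⱼ ∂ⱼVⱼ`, read off from the space-time derivative of a vector
field `V`. -/
noncomputable def spaceDiv (L : ℝ × Space N →L[ℝ] Space N) : ℝ := ∑ j, L (0, unitVec j) j

lemma hasDerivAt_slice {φ : ℝ → Space N → F} {t : ℝ} {x : Space N}
    (h : DifferentiableAt ℝ (Function.uncurry φ) (t, x)) :
    HasDerivAt (fun s => φ s x) (stDeriv φ t x (1, 0)) t := by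
  have hpair : HasFDerivAt (fun s : ℝ => (s, x)) (ContinuousLinearMap.inl ℝ ℝ (Space N)) t :=
    hasFDerivAt_prodMk_left t x
  have hslice : HasFDerivAt (fun s => φ s x)
      ((stDeriv φ t x).comp (ContinuousLinearMap.inl ℝ ℝ (Space N))) t :=
    HasFDerivAt.comp (g := Function.uncurry φ) t h.hasFDerivAt hpair
  simpa using hslice.hasDerivAt

lemma hasFDerivAt_slice {φ : ℝ → Space N → F} {t : ℝ} {x : Space N}
    (h : DifferentiableAt ℝ (Function.uncurry φ) (t, x)) :
    HasFDerivAt (φ t) ((stDeriv φ t x).comp (ContinuousLinearMap.inr ℝ ℝ (Space N))) x :=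
  HasFDerivAt.comp (g := Function.uncurry φ) x h.hasFDerivAt (hasFDerivAt_prodMk_right t x)

lemma fderiv_slice_apply {φ : ℝ → Space N → F} {t : ℝ} {x : Space N}
    (h : DifferentiableAt ℝ (Function.uncurry φ) (t, x)) (v : Space N) :
    fderiv ℝ (φ t) x v = stDeriv φ t x (0, v) := by
  rw [(hasFDerivAt_slice h).fderiv]
  rfl

lemma divergence_slice {φ : ℝ → Space N → Space N} {t : ℝ} {x : Space N}
    (h : DifferentiableAt ℝ (Function.uncurry φ) (t, x)) :
    divergence (φ t) x = spaceDiv (stDeriv φ t x) := by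
  simp only [divergence, spaceDiv, fderiv_slice_apply h]

lemma stDeriv_one_apply (φ : ℝ → Space N → F) (t : ℝ) (x v : Space N) :
    stDeriv φ t x (1, v) = stDeriv φ t x (1, 0) + stDeriv φ t x (0, v) := by
  rw [← map_add]
  simp

lemma sum_smul_map_unitVec (L : Space N →L[ℝ] F) (v : Space N) :
    ∑ j, v j • L (unitVec j) = L v := by
  have hv : ∑ j, v j • unitVec j = v := by
    simpa [unitVec] using (EuclideanSpace.basisFun (Fin N) ℝ).sum_repr v
  simpa only [map_sum, map_smul] using congrArg L hv

lemma norm_unitVec (j : Fin N) : ‖(unitVec j : Space N)‖ = 1 := by simp [unitVec]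

lemma inner_unitVec (v : Space N) (j : Fin N) : ⟪v, unitVec j⟫ = v j := by
  simp [unitVec, EuclideanSpace.inner_single_right]

variable [CompleteSpace F]

lemma measurable_stDeriv_apply [MeasurableSpace F] [BorelSpace F] (φ : ℝ → Space N → F)
    (v : ℝ × Space N) : Measurable fun z : ℝ × Space N => stDeriv φ z.1 z.2 v :=
  measurable_fderiv_apply_const ℝ (Function.uncurry φ) v

end SpaceTimeDerivative

section ClampTime

/-- The function of time that agrees with `g` on `[a,b]` and is frozen at its end values
outside. -/
def clampTime {α : Type*} (a b : ℝ) (g : ℝ → α) : ℝ → α := fun t => g (max a (min t b))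

variable {N : ℕ} {F : Type*} {a b : ℝ}

lemma clampTime_of_mem {α : Type*} (g : ℝ → α) {t : ℝ} (ht : t ∈ Icc a b) :
    clampTime a b g t = g t := by
  rw [clampTime, min_eq_left ht.2, max_eq_right ht.1]

lemma max_min_mem_Icc (hab : a ≤ b) (t : ℝ) : max a (min t b) ∈ Icc a b :=
  ⟨le_max_left _ _, max_le hab (min_le_right _ _)⟩

lemma clampTime_eventuallyEq (g : ℝ → Space N → F) {t : ℝ} (ht : t ∈ Ioo a b) (x : Space N) :
    Function.uncurry (clampTime a b g) =ᶠ[𝓝 (t, x)] Function.uncurry g := by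
  filter_upwards [continuous_fst.continuousAt.eventually (isOpen_Ioo.mem_nhds ht)] with z hz
  exact congrFun (clampTime_of_mem g (Ioo_subset_Icc_self hz)) z.2

lemma stDeriv_clampTime [NormedAddCommGroup F] [NormedSpace ℝ F] (g : ℝ → Space N → F) {t : ℝ}
    (ht : t ∈ Ioo a b) (x : Space N) : stDeriv (clampTime a b g) t x = stDeriv g t x :=
  (clampTime_eventuallyEq g ht x).fderiv_eq

end ClampTime

section C1Periodic

variable {N : ℕ} {F : Type*} [NormedAddCommGroup F] [NormedSpace ℝ F] {a b : ℝ}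

/-- Functions of class `C¹` on `[a,b] × Ω`. -/
structure IsC1Periodic (a b : ℝ) (g : ℝ → Space N → F) : Prop where
  contDiffOn : ContDiffOn ℝ 1 (Function.uncurry g) (Icc a b ×ˢ univ)
  periodic : ∀ t ∈ Icc a b, IsPeriodic (g t)

namespace IsC1Periodic

variable {g : ℝ → Space N → F} {t : ℝ}

section Algebra

variable {f : ℝ → Space N → ℝ}

lemma add {g' : ℝ → Space N → F} (hg : IsC1Periodic a b g) (hg' : IsC1Periodic a b g') :
    IsC1Periodic a b fun t x => g t x + g' t x :=
  ⟨hg.contDiffOn.add hg'.contDiffOn, fun t ht i x => by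
    simp only [hg.periodic t ht i x, hg'.periodic t ht i x]⟩

lemma sub {g' : ℝ → Space N → F} (hg : IsC1Periodic a b g) (hg' : IsC1Periodic a b g') :
    IsC1Periodic a b fun t x => g t x - g' t x :=
  ⟨hg.contDiffOn.sub hg'.contDiffOn, fun t ht i x => by
    simp only [hg.periodic t ht i x, hg'.periodic t ht i x]⟩

lemma smul (hf : IsC1Periodic a b f) (hg : IsC1Periodic a b g) :
    IsC1Periodic a b fun t x => f t x • g t x :=
  ⟨hf.contDiffOn.smul hg.contDiffOn, fun t ht i x => by
    simp only [hf.periodic t ht i x, hg.periodic t ht i x]⟩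

lemma inner {G : Type*} [NormedAddCommGroup G] [InnerProductSpace ℝ G] {g g' : ℝ → Space N → G}
    (hg : IsC1Periodic a b g) (hg' : IsC1Periodic a b g') :
    IsC1Periodic a b fun t x => ⟪g t x, g' t x⟫ :=
  ⟨hg.contDiffOn.inner ℝ hg'.contDiffOn, fun t ht i x => by
    simp only [hg.periodic t ht i x, hg'.periodic t ht i x]⟩

lemma comp {G : Type*} [NormedAddCommGroup G] [NormedSpace ℝ G] (hg : IsC1Periodic a b g)
    {q : F → G} {s : Set F} (hq : ContDiffOn ℝ 1 q s) (hs : ∀ t ∈ Icc a b, ∀ x, g t x ∈ s) :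
    IsC1Periodic a b fun t x => q (g t x) :=
  ⟨hq.comp hg.contDiffOn fun z hz => hs z.1 hz.1 z.2, fun t ht i x => by
    simp only [hg.periodic t ht i x]⟩

end Algebra

lemma of_isTest {φ : ℝ → Space N → F} (h : IsTest φ) : IsC1Periodic a b φ :=
  ⟨(h.smooth.of_le (by exact_mod_cast le_top)).contDiffOn, fun t _ => h.periodic t⟩

lemma contDiffAt (h : IsC1Periodic a b g) (ht : t ∈ Ioo a b) (x : Space N) :
    ContDiffAt ℝ 1 (Function.uncurry g) (t, x) :=
  h.contDiffOn.contDiffAt (prod_mem_nhds (Icc_mem_nhds ht.1 ht.2) univ_mem)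

lemma differentiableAt (h : IsC1Periodic a b g) (ht : t ∈ Ioo a b) (x : Space N) :
    DifferentiableAt ℝ (Function.uncurry g) (t, x) :=
  (h.contDiffAt ht x).differentiableAt (by simp)

lemma continuous_slice (h : IsC1Periodic a b g) (ht : t ∈ Icc a b) : Continuous (g t) :=
  h.contDiffOn.continuousOn.comp_continuous (f := fun x => (t, x)) (by fun_prop)
    fun _ => ⟨ht, trivial⟩

lemma exists_norm_le_ball (h : IsC1Periodic a b g) (R : ℝ) :
    ∃ C, ∀ t ∈ Icc a b, ∀ x ∈ Metric.ball (0 : Space N) R, ‖g t x‖ ≤ C := by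
  obtain ⟨C, hC⟩ := (isCompact_Icc.prod
    (isCompact_closedBall (0 : Space N) R)).exists_bound_of_continuousOn
    (h.contDiffOn.continuousOn.mono (prod_mono_right (subset_univ _)))
  exact ⟨C, fun t ht x hx => hC (t, x) ⟨ht, Metric.ball_subset_closedBall hx⟩⟩

lemma exists_norm_le (h : IsC1Periodic a b g) :
    ∃ C, ∀ t ∈ Icc a b, ∀ x ∈ cell N, ‖g t x‖ ≤ C := by
  obtain ⟨R, hR⟩ := exists_cell_subset_ball N
  obtain ⟨C, hC⟩ := h.exists_norm_le_ball R
  exact ⟨C, fun t ht x hx => hC t ht x (hR hx)⟩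

lemma continuous_clampTime (h : IsC1Periodic a b g) (hab : a ≤ b) :
    Continuous (Function.uncurry (clampTime a b g)) :=
  h.contDiffOn.continuousOn.comp_continuous
    (f := fun z : ℝ × Space N => (max a (min z.1 b), z.2)) (by fun_prop)
    fun z => ⟨max_min_mem_Icc hab z.1, trivial⟩

lemma exists_lipschitzOnWith_clampTime (h : IsC1Periodic a b g) (hab : a ≤ b) (R : ℝ) :
    ∃ K, LipschitzOnWith K (Function.uncurry (clampTime a b g)) (univ ×ˢ Metric.ball 0 R) := by
  obtain ⟨K, hK⟩ := (h.contDiffOn.mono (prod_mono_right (subset_univ _))).exists_lipschitzOnWith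
    (by simp) ((convex_Icc a b).prod (convex_closedBall (0 : Space N) R))
    (isCompact_Icc.prod (isCompact_closedBall _ _))
  have hclamp : LipschitzWith 1 fun z : ℝ × Space N => (max a (min z.1 b), z.2) := by
    simpa using ((LipschitzWith.prod_fst.min_const b).const_max a).prodMk LipschitzWith.prod_snd
  exact ⟨K * 1, hK.comp hclamp.lipschitzOnWith fun z hz =>
    ⟨max_min_mem_Icc hab _, Metric.ball_subset_closedBall hz.2⟩⟩

lemma exists_norm_stDeriv_le (h : IsC1Periodic a b g) :
    ∃ C, ∀ t ∈ Ioo a b, ∀ x ∈ cell N, ‖stDeriv g t x‖ ≤ C := by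
  rcases lt_or_ge b a with hba | hab
  · exact ⟨0, fun t ht => absurd (ht.1.trans ht.2) hba.not_gt⟩
  obtain ⟨R, hR⟩ := exists_cell_subset_ball N
  obtain ⟨K, hK⟩ := h.exists_lipschitzOnWith_clampTime hab R
  refine ⟨K, fun t ht x hx => ?_⟩
  rw [← stDeriv_clampTime g ht]
  exact norm_fderiv_le_of_lipschitzOn ℝ
    (prod_mem_nhds univ_mem (Metric.isOpen_ball.mem_nhds (hR hx))) hK

variable [CompleteSpace F]

lemma exists_isTest_approx (h : IsC1Periodic a b g) (hab : a ≤ b) :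
    ∃ φ : ℕ → ℝ → Space N → F, (∀ n, IsTest (φ n)) ∧
      (∃ C, ∀ n t, ∀ x ∈ cell N, ‖φ n t x‖ ≤ C ∧ ‖stDeriv (φ n) t x‖ ≤ C) ∧
      (∀ t ∈ Icc a b, ∀ x, Tendsto (fun n => φ n t x) atTop (𝓝 (g t x))) ∧
      ∀ t ∈ Ioo a b, ∀ x, Tendsto (fun n => stDeriv (φ n) t x) atTop (𝓝 (stDeriv g t x)) := by
  have hcont := h.continuous_clampTime hab
  have hloc : LocallyIntegrable (Function.uncurry (clampTime a b g)) volume :=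
    hcont.locallyIntegrable
  obtain ⟨R, hR⟩ := exists_cell_subset_ball N
  obtain ⟨C, hC⟩ := h.exists_norm_le_ball (R + 1)
  obtain ⟨K, hK⟩ := h.exists_lipschitzOnWith_clampTime hab (R + 2)
  have hball : ∀ {δ : ℝ} {z y : ℝ × Space N}, z.2 ∈ cell N → y ∈ Metric.ball z δ →
      y.2 ∈ Metric.ball 0 (R + δ) := fun {δ z y} hz hy => by
    have h1 : dist z.2 0 < R := hR hz
    have h2 : dist y.2 z.2 < δ := (le_max_right _ _).trans_lt hy
    exact (dist_triangle y.2 z.2 0).trans_lt (by linarith)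
  refine ⟨fun n t x => mollify volume n (Function.uncurry (clampTime a b g)) (t, x),
    fun n => ⟨contDiff_mollify hloc, fun t i x => ?_⟩,
    ⟨max C K, fun n t x hx => ⟨le_max_of_le_left ?_, le_max_of_le_right ?_⟩⟩,
    fun t ht x => ?_, fun t ht x => ?_⟩
  · simpa using mollify_add_period (μ := volume) (n := n)
      (f := Function.uncurry (clampTime a b g)) (c := ((0 : ℝ), (2 : ℝ) • unitVec i))
      (fun z => by
        simpa [Function.uncurry, clampTime] using h.periodic _ (max_min_mem_Icc hab z.1) i z.2)
      (t, x)
  · exact norm_mollify_le fun y hy => hC _ (max_min_mem_Icc hab y.1) y.2 (hball hx hy)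
  · have happ : ApproximatesLinearOn (Function.uncurry (clampTime a b g))
        (0 : ℝ × Space N →L[ℝ] F) (univ ×ˢ Metric.ball 0 (R + 2)) K :=
      LipschitzOnWith.approximatesLinearOn (by simpa using hK)
    have hle := norm_fderiv_mollify_sub_le (n := n) hloc happ (x := (t, x))
      ((shrinkingBump_rOut_le_one n).trans_lt one_lt_two) fun y hy => ⟨trivial, hball hx hy⟩
    rw [sub_zero] at hle
    exact hle
  · simpa only [Function.uncurry, clampTime_of_mem g ht] using
      mollify_tendsto (μ := volume) hcont (t, x)
  · rw [← stDeriv_clampTime g ht]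
    exact fderiv_mollify_tendsto hloc <| ((h.contDiffAt ht x).congr_of_eventuallyEq
      (clampTime_eventuallyEq g ht x)).hasStrictFDerivAt (by simp)

end IsC1Periodic

end C1Periodic

/-! ### Orthogonality to smooth periodic functions -/

section Orthogonality

variable {N : ℕ}

/-- The representative in `[-1,1)^N` of a point of the torus; composition with it is the periodic
extension of a function on the cell. -/
noncomputable def wrap (x : Space N) : Space N :=
  WithLp.toLp 2 fun i => toIcoMod (two_pos : (0 : ℝ) < 2) (-1) (x i)

lemma measurable_wrap : Measurable (wrap : Space N → Space N) := by
  refine (PiLp.continuous_toLp 2 _).measurable.comp (measurable_pi_lambda _ fun i => ?_)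
  simp only [toIcoMod_eq_add_fract_mul]
  fun_prop

lemma wrap_mem_cell (x : Space N) : wrap x ∈ cell N := fun i =>
  Ico_subset_Icc_self (by
    simpa [wrap, show (-1 : ℝ) + 2 = 1 by norm_num] using toIcoMod_mem_Ico two_pos (-1 : ℝ) (x i))

lemma isPeriodic_wrap : IsPeriodic (wrap : Space N → Space N) := fun i x => by
  ext j
  by_cases h : j = i
  · subst h
    simp [wrap, unitVec]
  · simp [wrap, unitVec, h]

lemma ae_wrap_eq (N : ℕ) : ∀ᵐ x ∂(cellMeasure N), wrap x = x := by
  have hIco : ∀ᵐ y ∂(volume.restrict (Icc (fun _ => -1) (fun _ => 1) : Set (Fin N → ℝ))),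
      y ∈ pi univ fun _ => Ico (-1 : ℝ) 1 := by
    have hset : (pi univ fun _ => Ico (-1) 1 : Set (Fin N → ℝ)) =ᵐ[volume]
        Icc (fun _ => -1) (fun _ => 1) :=
      Measure.univ_pi_Ico_ae_eq_Icc (f := fun _ => -1) (g := fun _ => 1)
    rw [← Measure.restrict_congr_set hset]
    exact ae_restrict_mem (MeasurableSet.univ_pi fun _ => measurableSet_Ico)
  filter_upwards [(measurePreserving_ofLp_cell N).quasiMeasurePreserving.ae hIco] with x hx
  ext i
  refine (toIcoMod_eq_self two_pos).2 ?_
  rw [show (-1 : ℝ) + 2 = 1 by norm_num]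
  exact hx i trivial

variable {F : Type*} [NormedAddCommGroup F] [MeasurableSpace F] [BorelSpace F]
  {w : Space N → F} {C : ℝ}

lemma exists_contDiff_periodic_approx [NormedSpace ℝ F] [FiniteDimensional ℝ F]
    (hw : Measurable w) (hC : ∀ x ∈ cell N, ‖w x‖ ≤ C) :
    ∃ ψ : ℕ → Space N → F, (∀ n, ContDiff ℝ ∞ (ψ n) ∧ IsPeriodic (ψ n)) ∧
      (∀ n x, ‖ψ n x‖ ≤ C) ∧
      ∀ᵐ x ∂(cellMeasure N), Tendsto (fun n => ψ n x) atTop (𝓝 (w x)) := by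
  have := FiniteDimensional.complete ℝ F
  have hbound : ∀ x, ‖w (wrap x)‖ ≤ C := fun x => hC _ (wrap_mem_cell x)
  have hloc : LocallyIntegrable (fun x => w (wrap x)) volume :=
    (locallyIntegrable_const C).mono (hw.comp measurable_wrap).aestronglyMeasurable
      (ae_of_all _ fun x => (hbound x).trans (le_abs_self C))
  refine ⟨fun n => mollify volume n fun x => w (wrap x), fun n => ⟨contDiff_mollify hloc,
    fun i => mollify_add_period fun x => by rw [isPeriodic_wrap i x]⟩,
    fun n x => norm_mollify_le fun y _ => hbound y, ?_⟩
  filter_upwards [ae_restrict_of_ae (ae_mollify_tendsto hloc), ae_wrap_eq N] with x hx hwrap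
  rwa [hwrap] at hx

lemma ae_eq_zero_of_forall_integral_inner_eq_zero [InnerProductSpace ℝ F] [FiniteDimensional ℝ F]
    (hw : Measurable w) (hC : ∀ x ∈ cell N, ‖w x‖ ≤ C)
    (horth : ∀ ψ : Space N → F, ContDiff ℝ ∞ ψ → IsPeriodic ψ →
      ∫ x, ⟪w x, ψ x⟫ ∂(cellMeasure N) = 0) : ∀ᵐ x ∂(cellMeasure N), w x = 0 := by
  obtain ⟨ψ, hψ, hψC, hlim⟩ := exists_contDiff_periodic_approx hw hC
  have hinner : ∀ x ∈ cell N, ∀ v : F, ‖v‖ ≤ C → ‖⟪w x, v⟫‖ ≤ C * C := fun x hx v hv =>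
    (norm_inner_le_norm _ _).trans
      (mul_le_mul (hC x hx) hv (norm_nonneg _) ((norm_nonneg _).trans (hC x hx)))
  have hself : ∫ x, ⟪w x, w x⟫ ∂(cellMeasure N) = 0 := by
    refine tendsto_nhds_unique (tendsto_integral_of_dominated_convergence
      (F := fun n x => ⟪w x, ψ n x⟫) (fun _ => C * C)
      (fun n => (hw.inner (hψ n).1.continuous.measurable).aestronglyMeasurable)
      (integrable_const _)
      (fun n => (ae_mem_cell N).mono fun x hx => hinner x hx _ (hψC n x))
      (hlim.mono fun x hx => tendsto_const_nhds.inner hx)) ?_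
    simp only [horth _ (hψ _).1 (hψ _).2, tendsto_const_nhds]
  have hint : Integrable (fun x => ⟪w x, w x⟫) (cellMeasure N) :=
    integrable_cell_of_bound (hw.inner hw).aestronglyMeasurable
      fun x hx => hinner x hx _ (hC x hx)
  filter_upwards [(integral_eq_zero_iff_of_nonneg (fun x => real_inner_self_nonneg) hint).1 hself]
    with x hx using inner_self_eq_zero.1 hx

end Orthogonality

/-! ### Balance laws in integral form -/

section IntegralConservation

variable {N : ℕ} {a b τ : ℝ} {g : ℝ → Space N → ℝ}

lemma stMeasure_add {c : ℝ} (hab : a ≤ b) (hbc : b ≤ c) :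
    stMeasure N a b + stMeasure N b c = stMeasure N a c := by
  rw [stMeasure, stMeasure, stMeasure, ← Measure.add_prod,
    ← Measure.restrict_union (Ioc_disjoint_Ioc_of_le le_rfl) measurableSet_Ioc,
    Ioc_union_Ioc_eq_Ioc hab hbc]

namespace IsC1Periodic

lemma aestronglyMeasurable_stMeasure {F : Type*} [NormedAddCommGroup F] [NormedSpace ℝ F]
    {φ : ℝ → Space N → F} (hφ : IsC1Periodic a b φ) (hτ : τ ≤ b) :
    AEStronglyMeasurable (fun z : ℝ × Space N => φ z.1 z.2) (stMeasure N a τ) := by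
  rw [← Measure.restrict_eq_self_of_ae_mem (s := Icc a b ×ˢ univ) ((ae_stMeasure_mem a τ).mono
    fun z hz => ⟨⟨hz.1.1.le, hz.1.2.le.trans hτ⟩, trivial⟩)]
  exact hφ.contDiffOn.continuousOn.aestronglyMeasurable (measurableSet_Icc.prod .univ)

lemma integrable_stMeasure (hg : IsC1Periodic a b g) (hτ : τ ≤ b) :
    Integrable (fun z => g z.1 z.2) (stMeasure N a τ) := by
  obtain ⟨C, hC⟩ := hg.exists_norm_le
  exact integrable_stMeasure_of_bound (hg.aestronglyMeasurable_stMeasure hτ)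
    fun t ht => hC t ⟨ht.1.le, ht.2.le.trans hτ⟩

lemma integrable_stDeriv_apply (hg : IsC1Periodic a b g) (hτ : τ ≤ b) (v : ℝ × Space N) :
    Integrable (fun z => stDeriv g z.1 z.2 v) (stMeasure N a τ) := by
  obtain ⟨C, hC⟩ := hg.exists_norm_stDeriv_le
  exact integrable_stMeasure_of_bound (measurable_stDeriv_apply g v).aestronglyMeasurable
    fun t ht x hx => (stDeriv g t x).le_of_opNorm_le (hC t ⟨ht.1, ht.2.trans_le hτ⟩ x hx) v

lemma integrable_slice (hg : IsC1Periodic a b g) (hτ : τ ∈ Icc a b) :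
    Integrable (g τ) (cellMeasure N) := by
  obtain ⟨C, hC⟩ := hg.exists_norm_le
  exact integrable_cell_of_bound (hg.continuous_slice hτ).aestronglyMeasurable (hC τ hτ)

lemma integral_slice_sub_integral_slice (hg : IsC1Periodic a b g) (hτ : τ ∈ Icc a b) :
    ∫ x, g τ x ∂(cellMeasure N) - ∫ x, g a x ∂(cellMeasure N)
      = ∫ z, stDeriv g z.1 z.2 (1, 0) ∂(stMeasure N a τ) := by
  have hint := hg.integrable_stDeriv_apply hτ.2 (1, 0)
  rw [← integral_sub (hg.integrable_slice hτ)
    (hg.integrable_slice (left_mem_Icc.2 (hτ.1.trans hτ.2))), stMeasure, integral_prod_symm _ hint]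
  refine integral_congr_ae ?_
  filter_upwards [hint.prod_left_ae] with x hx
  rw [← intervalIntegral.integral_of_le hτ.1]
  refine (intervalIntegral.integral_eq_sub_of_hasDerivAt_of_le hτ.1 ?_ (fun t ht =>
    hasDerivAt_slice (hg.differentiableAt ⟨ht.1, ht.2.trans_le hτ.2⟩ x))
    ((intervalIntegrable_iff_integrableOn_Ioc_of_le hτ.1).2 hx)).symm
  exact hg.contDiffOn.continuousOn.comp (f := fun t => (t, x)) (by fun_prop)
    fun t ht => ⟨Icc_subset_Icc_right hτ.2 ht, trivial⟩

lemma integral_stDeriv_unitVec_eq_zero (hg : IsC1Periodic a b g) (hτ : τ ≤ b) (j : Fin N) :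
    ∫ z, stDeriv g z.1 z.2 (0, unitVec j) ∂(stMeasure N a τ) = 0 := by
  have hint := hg.integrable_stDeriv_apply hτ (0, unitVec j)
  rw [stMeasure, integral_prod _ hint]
  refine integral_eq_zero_of_ae ?_
  filter_upwards [hint.prod_right_ae, ae_mem_Ioo a τ] with t hint_t ht
  have hmem : t ∈ Ioo a b := ⟨ht.1, ht.2.trans_le hτ⟩
  simp only [← fderiv_slice_apply (hg.differentiableAt hmem _)] at hint_t ⊢
  exact integral_fderiv_unitVec_eq_zero
    (fun x => (hasFDerivAt_slice (hg.differentiableAt hmem x)).differentiableAt)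
    (hg.periodic t (Ioo_subset_Icc_self hmem)) j hint_t

lemma integral_slice_sub_eq_integral_stDeriv_add_sum {w : Fin N → ℝ → Space N → ℝ}
    (hg : IsC1Periodic a b g) (hw : ∀ j, IsC1Periodic a b (w j)) (hτ : τ ∈ Icc a b) :
    ∫ x, g τ x ∂(cellMeasure N) - ∫ x, g a x ∂(cellMeasure N)
      = ∫ z, (stDeriv g z.1 z.2 (1, 0) + ∑ j, stDeriv (w j) z.1 z.2 (0, unitVec j))
          ∂(stMeasure N a τ) := by
  have hint := fun j => (hw j).integrable_stDeriv_apply hτ.2 (0, unitVec j)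
  rw [integral_add (hg.integrable_stDeriv_apply hτ.2 (1, 0)) (integrable_finsetSum _ fun j _ =>
    hint j), integral_finsetSum _ fun j _ => hint j,
    Finset.sum_eq_zero fun j _ => (hw j).integral_stDeriv_unitVec_eq_zero hτ.2 j, add_zero,
    hg.integral_slice_sub_integral_slice hτ]

end IsC1Periodic

end IntegralConservation

section GlueAt

variable {α : Type*} {b t : ℝ}

/-- The function of time that agrees with `g₁` up to time `b` and with `g₂` afterwards. -/
noncomputable def glueAt (b : ℝ) (g₁ g₂ : ℝ → α) (t : ℝ) : α := if t ≤ b then g₁ t else g₂ t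

lemma glueAt_of_le (g₁ g₂ : ℝ → α) (h : t ≤ b) : glueAt b g₁ g₂ t = g₁ t :=
  if_pos h

lemma glueAt_of_lt (g₁ g₂ : ℝ → α) (h : b < t) : glueAt b g₁ g₂ t = g₂ t :=
  if_neg h.not_ge

lemma measurable_glueAt {N : ℕ} {G : Type*} [MeasurableSpace G] {g₁ g₂ : ℝ → Space N → G}
    (h₁ : Measurable (Function.uncurry g₁)) (h₂ : Measurable (Function.uncurry g₂)) :
    Measurable (Function.uncurry (glueAt b g₁ g₂)) := by
  convert Measurable.ite (measurableSet_le measurable_fst measurable_const) h₁ h₂ using 2 with z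
  exact apply_ite (fun h : Space N → G => h z.2) (z.1 ≤ b) (g₁ z.1) (g₂ z.1)

end GlueAt

section BalanceLaw

variable {N : ℕ} {G : Type*} [NormedAddCommGroup G] [InnerProductSpace ℝ G]
  {a b c τ : ℝ} {q q₁ q₂ : ℝ → Space N → G} {f f₁ f₂ : Fin N → ℝ → Space N → G}
  {φ : ℝ → Space N → G}

/-- The integrand `q · ∂ₜφ + ∑ⱼ fⱼ · ∂ⱼφ` of the weak form of `∂ₜq + ∑ⱼ ∂ⱼfⱼ = 0`. -/
noncomputable def weakIntegrand (q : ℝ → Space N → G) (f : Fin N → ℝ → Space N → G)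
    (φ : ℝ → Space N → G) (t : ℝ) (x : Space N) : ℝ :=
  ⟪q t x, stDeriv φ t x (1, 0)⟫ + ∑ j, ⟪f j t x, stDeriv φ t x (0, unitVec j)⟫

lemma stDeriv_inner {g g' : ℝ → Space N → G} {t : ℝ} {x : Space N}
    (hg : DifferentiableAt ℝ (Function.uncurry g) (t, x))
    (hg' : DifferentiableAt ℝ (Function.uncurry g') (t, x)) (v : ℝ × Space N) :
    stDeriv (fun t x => ⟪g t x, g' t x⟫) t x v
      = ⟪g t x, stDeriv g' t x v⟫ + ⟪stDeriv g t x v, g' t x⟫ :=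
  fderiv_inner_apply ℝ hg hg' v

lemma abs_weakIntegrand_le {C K t : ℝ} {x : Space N} (hq : ‖q t x‖ ≤ C)
    (hf : ∀ j, ‖f j t x‖ ≤ C) (hφ : ‖stDeriv φ t x‖ ≤ K) :
    |weakIntegrand q f φ t x| ≤ C * K + N * (C * K) := by
  have hinner : ∀ {y : G} {v : ℝ × Space N}, ‖y‖ ≤ C → ‖v‖ ≤ 1 →
      |⟪y, stDeriv φ t x v⟫| ≤ C * K := fun hy hv =>
    (abs_real_inner_le_norm _ _).trans <| mul_le_mul hy
      ((stDeriv φ t x).unit_le_opNorm _ hv |>.trans hφ) (norm_nonneg _) ((norm_nonneg _).trans hy)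
  calc |weakIntegrand q f φ t x|
      ≤ |⟪q t x, stDeriv φ t x (1, 0)⟫| + ∑ j, |⟪f j t x, stDeriv φ t x (0, unitVec j)⟫| :=
        (abs_add_le _ _).trans (add_le_add_right (Finset.abs_sum_le_sum_abs _ _) _)
    _ ≤ C * K + ∑ _j : Fin N, C * K := by
        gcongr with j
        · exact hinner hq (by simp)
        · exact hinner (hf j) (by simp [norm_unitVec])
    _ = C * K + N * (C * K) := by simp

lemma weakIntegrand_glueAt (t : ℝ) (x : Space N) :
    weakIntegrand (glueAt b q₁ q₂) (fun j => glueAt b (f₁ j) (f₂ j)) φ t x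
      = glueAt b (weakIntegrand q₁ f₁ φ) (weakIntegrand q₂ f₂ φ) t x := by
  rcases le_or_gt t b with h | h
  · simp only [weakIntegrand, glueAt_of_le _ _ h]
  · simp only [weakIntegrand, glueAt_of_lt _ _ h]

variable [MeasurableSpace G] [BorelSpace G]

/-- A density `q` and fluxes `fⱼ` that are measurable, and bounded on `[a,b] × Ω`. -/
structure IsBoundedField (a b : ℝ) (q : ℝ → Space N → G) (f : Fin N → ℝ → Space N → G) :
    Prop where
  measurable_density : Measurable (Function.uncurry q)
  measurable_flux : ∀ j, Measurable (Function.uncurry (f j))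
  bounded : ∃ C, ∀ t ∈ Icc a b, ∀ x ∈ cell N, ‖q t x‖ ≤ C ∧ ∀ j, ‖f j t x‖ ≤ C

/-- `∂ₜq + ∑ⱼ ∂ⱼfⱼ = 0` on `[a,b] × Ω` in the weak sense, for a bounded density `q` and bounded
fluxes `fⱼ`.  The law is imposed at every time `τ`, so that the slices `q τ` are the values of a
weakly continuous function of time. -/
structure IsBalanceLaw (a b : ℝ) (q : ℝ → Space N → G) (f : Fin N → ℝ → Space N → G) : Prop
    extends IsBoundedField a b q f where
  balance : ∀ φ : ℝ → Space N → G, IsTest φ → ∀ τ ∈ Icc a b,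
    ∫ x, ⟪q τ x, φ τ x⟫ ∂(cellMeasure N) - ∫ x, ⟪q a x, φ a x⟫ ∂(cellMeasure N)
      = ∫ z, weakIntegrand q f φ z.1 z.2 ∂(stMeasure N a τ)

lemma IsC1Periodic.isBalanceLaw_clampTime (hab : a ≤ b) (hq : IsC1Periodic a b q)
    (hf : ∀ j, IsC1Periodic a b (f j))
    (hlaw : ∀ t ∈ Ioo a b, ∀ x,
      stDeriv q t x (1, 0) + ∑ j, stDeriv (f j) t x (0, unitVec j) = 0) :
    IsBalanceLaw a b (clampTime a b q) fun j => clampTime a b (f j) where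
  measurable_density := (hq.continuous_clampTime hab).measurable
  measurable_flux j := ((hf j).continuous_clampTime hab).measurable
  bounded := by
    obtain ⟨C, hC⟩ := hq.exists_norm_le
    choose K hK using fun j => (hf j).exists_norm_le
    refine ⟨max C (∑ j, |K j|), fun t ht x hx => ?_⟩
    simp only [clampTime_of_mem _ ht]
    exact ⟨le_max_of_le_left (hC t ht x hx), fun j => le_max_of_le_right <|
      ((hK j t ht x hx).trans (le_abs_self _)).trans
        (Finset.single_le_sum (fun i _ => abs_nonneg (K i)) (Finset.mem_univ j))⟩
  balance φ hφ τ hτ := by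
    have hφ1 : IsC1Periodic a b φ := .of_isTest hφ
    rw [clampTime_of_mem _ hτ, clampTime_of_mem _ (left_mem_Icc.2 hab),
      (hq.inner hφ1).integral_slice_sub_eq_integral_stDeriv_add_sum (fun j => (hf j).inner hφ1) hτ]
    refine integral_congr_ae ?_
    filter_upwards [ae_stMeasure_mem a τ] with z hz
    have hmem : z.1 ∈ Ioo a b := ⟨hz.1.1, hz.1.2.trans_le hτ.2⟩
    have hdφ := hφ1.differentiableAt hmem z.2
    simp only [weakIntegrand, clampTime_of_mem _ (Ioo_subset_Icc_self hmem),
      stDeriv_inner (hq.differentiableAt hmem z.2) hdφ,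
      stDeriv_inner ((hf _).differentiableAt hmem z.2) hdφ, Finset.sum_add_distrib]
    have hpair := congrArg (fun v : G => ⟪v, φ z.1 z.2⟫) (hlaw z.1 hmem z.2)
    simp only [inner_add_left, sum_inner, inner_zero_left] at hpair
    linarith

variable [FiniteDimensional ℝ G]

lemma measurable_weakIntegrand (hq : Measurable (Function.uncurry q))
    (hf : ∀ j, Measurable (Function.uncurry (f j))) (φ : ℝ → Space N → G) :
    Measurable fun z : ℝ × Space N => weakIntegrand q f φ z.1 z.2 :=
  (hq.inner (measurable_stDeriv_apply φ _)).add <|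
    Finset.measurable_fun_sum _ fun j _ => (hf j).inner (measurable_stDeriv_apply φ _)

namespace IsBoundedField

lemma integrable_weakIntegrand (h : IsBoundedField a b q f) (hφ : IsC1Periodic a b φ) {d : ℝ}
    (hac : a ≤ c) (hdb : d ≤ b) :
    Integrable (fun z => weakIntegrand q f φ z.1 z.2) (stMeasure N c d) := by
  obtain ⟨C, hC⟩ := h.bounded
  obtain ⟨K, hK⟩ := hφ.exists_norm_stDeriv_le
  refine integrable_stMeasure_of_bound (C := C * K + N * (C * K))
    (measurable_weakIntegrand h.measurable_density h.measurable_flux φ).aestronglyMeasurable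
    fun t ht x hx => ?_
  have hmem : t ∈ Ioo a b := Ioo_subset_Ioo hac hdb ht
  have hqf := hC t (Ioo_subset_Icc_self hmem) x hx
  exact abs_weakIntegrand_le hqf.1 hqf.2 (hK t hmem x hx)

lemma integrable_stMeasure_inner (h : IsBoundedField a b q f) (hφ : IsC1Periodic a b φ)
    (hτ : τ ≤ b) : Integrable (fun z => ⟪q z.1 z.2, φ z.1 z.2⟫) (stMeasure N a τ) := by
  obtain ⟨C, hC⟩ := h.bounded
  obtain ⟨K, hK⟩ := hφ.exists_norm_le
  refine integrable_stMeasure_of_bound (C := C * K)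
    (h.measurable_density.aestronglyMeasurable.inner (hφ.aestronglyMeasurable_stMeasure hτ))
    fun t ht x hx => ?_
  have hmem : t ∈ Icc a b := ⟨ht.1.le, ht.2.le.trans hτ⟩
  have hq := (hC t hmem x hx).1
  exact (norm_inner_le_norm _ _).trans
    (mul_le_mul hq (hK t hmem x hx) (norm_nonneg _) ((norm_nonneg _).trans hq))

lemma integrable_slice_inner (h : IsBoundedField a b q f) (hφ : IsC1Periodic a b φ)
    (hτ : τ ∈ Icc a b) : Integrable (fun x => ⟪q τ x, φ τ x⟫) (cellMeasure N) := by
  obtain ⟨C, hC⟩ := h.bounded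
  obtain ⟨K, hK⟩ := hφ.exists_norm_le
  refine integrable_cell_of_bound (C := C * K) ((measurable_slice h.measurable_density τ).inner
    (hφ.continuous_slice hτ).measurable).aestronglyMeasurable fun x hx => ?_
  have hq := (hC τ hτ x hx).1
  exact (norm_inner_le_norm _ _).trans
    (mul_le_mul hq (hK τ hτ x hx) (norm_nonneg _) ((norm_nonneg _).trans hq))

lemma balance_iff_iterated (h : IsBoundedField a b q f) (hφ : IsC1Periodic a b φ)
    (hτ : τ ∈ Icc a b) :
    ∫ x, ⟪q τ x, φ τ x⟫ ∂(cellMeasure N) - ∫ x, ⟪q a x, φ a x⟫ ∂(cellMeasure N)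
        = ∫ z, weakIntegrand q f φ z.1 z.2 ∂(stMeasure N a τ) ↔
      ∫ x, (⟪q τ x, φ τ x⟫ - ⟪q a x, φ a x⟫) ∂(cellMeasure N)
        = ∫ t in a..τ, ∫ x, weakIntegrand q f φ t x ∂(cellMeasure N) := by
  rw [integral_sub (h.integrable_slice_inner hφ hτ)
    (h.integrable_slice_inner hφ (left_mem_Icc.2 (hτ.1.trans hτ.2))),
    intervalIntegral_eq_stMeasure hτ.1 (h.integrable_weakIntegrand hφ le_rfl hτ.2)]

end IsBoundedField

namespace IsBalanceLaw

lemma mono (h : IsBalanceLaw a b q f) {d : ℝ} (hac : a ≤ c) (hdb : d ≤ b) :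
    IsBalanceLaw c d q f where
  measurable_density := h.measurable_density
  measurable_flux := h.measurable_flux
  bounded := h.bounded.imp fun _ hC t ht => hC t (Icc_subset_Icc hac hdb ht)
  balance φ hφ τ hτ := by
    have hint := fun {c d} => h.integrable_weakIntegrand (.of_isTest hφ) (c := c) (d := d)
    have hc := h.balance φ hφ c ⟨hac, hτ.1.trans (hτ.2.trans hdb)⟩
    have hτ' := h.balance φ hφ τ ⟨hac.trans hτ.1, hτ.2.trans hdb⟩
    rw [← stMeasure_add hac hτ.1, integral_add_measure
      (hint le_rfl (hτ.1.trans (hτ.2.trans hdb))) (hint hac (hτ.2.trans hdb)), ← hc] at hτ'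
    linarith

lemma glue (h₁ : IsBalanceLaw a b q₁ f₁) (h₂ : IsBalanceLaw b c q₂ f₂) (hab : a ≤ b)
    (hb : ∀ᵐ x ∂(cellMeasure N), q₁ b x = q₂ b x) :
    IsBalanceLaw a c (glueAt b q₁ q₂) fun j => glueAt b (f₁ j) (f₂ j) where
  measurable_density := measurable_glueAt h₁.measurable_density h₂.measurable_density
  measurable_flux j := measurable_glueAt (h₁.measurable_flux j) (h₂.measurable_flux j)
  bounded := by
    obtain ⟨C₁, hC₁⟩ := h₁.bounded
    obtain ⟨C₂, hC₂⟩ := h₂.bounded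
    refine ⟨max C₁ C₂, fun t ht x hx => ?_⟩
    rcases le_or_gt t b with h | h
    · simp only [glueAt_of_le _ _ h]
      have hqf := hC₁ t ⟨ht.1, h⟩ x hx
      exact ⟨le_max_of_le_left hqf.1, fun j => le_max_of_le_left (hqf.2 j)⟩
    · simp only [glueAt_of_lt _ _ h]
      have hqf := hC₂ t ⟨h.le, ht.2⟩ x hx
      exact ⟨le_max_of_le_right hqf.1, fun j => le_max_of_le_right (hqf.2 j)⟩
  balance φ hφ τ hτ := by
    have hbefore : ∀ {d}, d ≤ b → (fun z => glueAt b (weakIntegrand q₁ f₁ φ)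
        (weakIntegrand q₂ f₂ φ) z.1 z.2) =ᵐ[stMeasure N a d]
        fun z => weakIntegrand q₁ f₁ φ z.1 z.2 := fun hd => by
      filter_upwards [ae_stMeasure_mem a _] with z hz
      rw [glueAt_of_le _ _ (hz.1.2.le.trans hd)]
    simp only [weakIntegrand_glueAt, glueAt_of_le _ _ hab]
    rcases le_or_gt τ b with h | h
    · rw [integral_congr_ae (hbefore h), glueAt_of_le _ _ h]
      exact h₁.balance φ hφ τ ⟨hτ.1, h⟩
    have hafter : (fun z => glueAt b (weakIntegrand q₁ f₁ φ) (weakIntegrand q₂ f₂ φ) z.1 z.2)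
        =ᵐ[stMeasure N b τ] fun z => weakIntegrand q₂ f₂ φ z.1 z.2 := by
      filter_upwards [ae_stMeasure_mem b τ] with z hz
      rw [glueAt_of_lt _ _ hz.1.1]
    have hmid : ∫ x, ⟪q₁ b x, φ b x⟫ ∂(cellMeasure N) = ∫ x, ⟪q₂ b x, φ b x⟫ ∂(cellMeasure N) :=
      integral_congr_ae (hb.mono fun x hx => by simp only [hx])
    rw [← stMeasure_add hab h.le, integral_add_measure
      ((h₁.integrable_weakIntegrand (.of_isTest hφ) le_rfl le_rfl).congr (hbefore le_rfl).symm)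
      ((h₂.integrable_weakIntegrand (.of_isTest hφ) le_rfl hτ.2).congr hafter.symm),
      integral_congr_ae (hbefore le_rfl), integral_congr_ae hafter, glueAt_of_lt _ _ h,
      ← h₁.balance φ hφ b ⟨hab, le_rfl⟩, ← h₂.balance φ hφ τ ⟨h.le, hτ.2⟩, hmid]
    ring

lemma balance_of_isC1Periodic (h : IsBalanceLaw a b q f) (hφ : IsC1Periodic a b φ)
    (hτ : τ ∈ Icc a b) :
    ∫ x, ⟪q τ x, φ τ x⟫ ∂(cellMeasure N) - ∫ x, ⟪q a x, φ a x⟫ ∂(cellMeasure N)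
      = ∫ z, weakIntegrand q f φ z.1 z.2 ∂(stMeasure N a τ) := by
  have hab : a ≤ b := hτ.1.trans hτ.2
  obtain ⟨ψ, hψ, ⟨K, hK⟩, hlim, hdlim⟩ := hφ.exists_isTest_approx hab
  obtain ⟨C, hC⟩ := h.bounded
  have hslice : ∀ t ∈ Icc a b, Tendsto (fun n => ∫ x, ⟪q t x, ψ n t x⟫ ∂(cellMeasure N)) atTop
      (𝓝 (∫ x, ⟪q t x, φ t x⟫ ∂(cellMeasure N))) := fun t ht => by
    refine tendsto_integral_of_dominated_convergence (fun _ => C * K)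
      (fun n => ((measurable_slice h.measurable_density t).inner (measurable_slice
        (hψ n).smooth.continuous.measurable t)).aestronglyMeasurable) (integrable_const _)
      (fun n => (ae_mem_cell N).mono fun x hx => ?_)
      (ae_of_all _ fun x => tendsto_const_nhds.inner (hlim t ht x))
    have hq := (hC t ht x hx).1
    exact (norm_inner_le_norm _ _).trans
      (mul_le_mul hq (hK n t x hx).1 (norm_nonneg _) ((norm_nonneg _).trans hq))
  have hintegrand : Tendsto (fun n => ∫ z, weakIntegrand q f (ψ n) z.1 z.2 ∂(stMeasure N a τ))
      atTop (𝓝 (∫ z, weakIntegrand q f φ z.1 z.2 ∂(stMeasure N a τ))) := by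
    refine tendsto_integral_of_dominated_convergence (fun _ => C * K + N * (C * K)) (fun n =>
      (measurable_weakIntegrand h.measurable_density h.measurable_flux _).aestronglyMeasurable)
      (integrable_const _) (fun n => ?_) ?_
    · filter_upwards [ae_stMeasure_mem a τ] with z hz
      have hqf := hC z.1 ⟨hz.1.1.le, hz.1.2.le.trans hτ.2⟩ z.2 hz.2
      exact abs_weakIntegrand_le hqf.1 hqf.2 (hK n z.1 z.2 hz.2).2
    · filter_upwards [ae_stMeasure_mem a τ] with z hz
      have hL := fun v => ((ContinuousLinearMap.apply ℝ G v).continuous.tendsto _).comp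
        (hdlim z.1 ⟨hz.1.1, hz.1.2.trans_le hτ.2⟩ z.2)
      exact (tendsto_const_nhds.inner (hL _)).add
        (tendsto_finsetSum _ fun j _ => tendsto_const_nhds.inner (hL _))
  refine tendsto_nhds_unique ((hslice τ hτ).sub (hslice a (left_mem_Icc.2 hab))) ?_
  simpa only [h.balance _ (hψ _) τ hτ] using hintegrand

lemma ae_eq (h₁ : IsBalanceLaw a b q₁ f₁) (h₂ : IsBalanceLaw a b q₂ f₂)
    (ha : ∀ᵐ x ∂(cellMeasure N), q₁ a x = q₂ a x)
    (hst : ∀ᵐ z ∂(stMeasure N a b),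
      q₁ z.1 z.2 = q₂ z.1 z.2 ∧ ∀ j, f₁ j z.1 z.2 = f₂ j z.1 z.2) (hτ : τ ∈ Icc a b) :
    ∀ᵐ x ∂(cellMeasure N), q₁ τ x = q₂ τ x := by
  obtain ⟨C₁, hC₁⟩ := h₁.bounded
  obtain ⟨C₂, hC₂⟩ := h₂.bounded
  have hm₁ := measurable_slice h₁.measurable_density τ
  have hm₂ := measurable_slice h₂.measurable_density τ
  rw [← stMeasure_add hτ.1 hτ.2, ae_add_measure_iff] at hst
  refine (ae_eq_zero_of_forall_integral_inner_eq_zero (w := fun x => q₁ τ x - q₂ τ x)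
    (hm₁.sub hm₂) (C := C₁ + C₂) (fun x hx => (norm_sub_le _ _).trans
      (add_le_add (hC₁ τ hτ x hx).1 (hC₂ τ hτ x hx).1)) fun ψ hψ hper => ?_).mono
    fun x => sub_eq_zero.1
  have hφ : IsTest fun (_ : ℝ) x => ψ x := ⟨hψ.comp contDiff_snd, fun _ => hper⟩
  have hinit : ∫ x, ⟪q₁ a x, ψ x⟫ ∂(cellMeasure N) = ∫ x, ⟪q₂ a x, ψ x⟫ ∂(cellMeasure N) :=
    integral_congr_ae (ha.mono fun x hx => by simp only [hx])
  have hflux : ∫ z, weakIntegrand q₁ f₁ (fun _ x => ψ x) z.1 z.2 ∂(stMeasure N a τ)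
      = ∫ z, weakIntegrand q₂ f₂ (fun _ x => ψ x) z.1 z.2 ∂(stMeasure N a τ) :=
    integral_congr_ae (hst.1.mono fun z hz => by simp only [weakIntegrand, hz.1, hz.2])
  have hslice := (h₁.balance _ hφ τ hτ).trans (hflux.trans (h₂.balance _ hφ τ hτ).symm)
  rw [hinit, sub_left_inj] at hslice
  have hint₁ := h₁.integrable_slice_inner (.of_isTest hφ) hτ
  have hint₂ := h₂.integrable_slice_inner (.of_isTest hφ) hτ
  simp only [inner_sub_left]
  rw [integral_sub hint₁ hint₂, hslice, sub_self]

end IsBalanceLaw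

end BalanceLaw

/-! ### The Euler system as a pair of balance laws -/

section PressureFunction

variable {p : ℝ → ℝ}

lemma measurable_comp_of_continuousOn_Ici {α : Type*} [MeasurableSpace α]
    (hp : ContinuousOn p (Ici 0)) {f : α → ℝ} (hf : Measurable f) (hf₀ : ∀ a, 0 ≤ f a) :
    Measurable fun a => p (f a) := by
  have hmax : Continuous fun z => p (max z 0) :=
    hp.comp_continuous (by fun_prop) fun z => mem_Ici.2 (le_max_right _ _)
  simpa only [Function.comp_def, max_eq_left (hf₀ _)] using hmax.measurable.comp hf

lemma exists_abs_le_of_continuousOn_Ici (hp : ContinuousOn p (Ici 0)) (C : ℝ) :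
    ∃ M, ∀ z, 0 ≤ z → z ≤ C → |p z| ≤ M := by
  obtain ⟨M, hM⟩ := isCompact_Icc.exists_bound_of_continuousOn
    (hp.mono (Icc_subset_Ici_self : Icc 0 C ⊆ Ici 0))
  exact ⟨M, fun z h₀ h₁ => hM z ⟨h₀, h₁⟩⟩

end PressureFunction

section EulerFluxes

variable {N : ℕ} {p : ℝ → ℝ} {a b c C τ : ℝ} {ρ : ℝ → Space N → ℝ} {u : ℝ → Space N → Space N}

/-- The components `ρ uⱼ` of the mass flux. -/
def massFlux (ρ : ℝ → Space N → ℝ) (u : ℝ → Space N → Space N) (j : Fin N) (t : ℝ)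
    (x : Space N) : ℝ :=
  ρ t x * u t x j

/-- The momentum density `ρ u`. -/
noncomputable def momentumDensity (ρ : ℝ → Space N → ℝ) (u : ℝ → Space N → Space N) (t : ℝ)
    (x : Space N) : Space N :=
  ρ t x • u t x

/-- The `j`-th column `ρ uⱼ u + p(ρ) eⱼ` of the momentum flux `ρ u ⊗ u + p(ρ) 𝕀`. -/
noncomputable def momentumFlux (p : ℝ → ℝ) (ρ : ℝ → Space N → ℝ) (u : ℝ → Space N → Space N)
    (j : Fin N) (t : ℝ) (x : Space N) : Space N :=
  (ρ t x * u t x j) • u t x + p (ρ t x) • unitVec j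

lemma sum_smul_stDeriv_unitVec {F : Type*} [NormedAddCommGroup F] [NormedSpace ℝ F]
    (φ : ℝ → Space N → F) (t : ℝ) (x v : Space N) :
    ∑ j, v j • stDeriv φ t x (0, unitVec j) = stDeriv φ t x (0, v) := by
  simpa using sum_smul_map_unitVec ((stDeriv φ t x).comp (.inr ℝ ℝ (Space N))) v

lemma inner_eq_mul (s t : ℝ) : ⟪s, t⟫ = s * t := by
  simp [mul_comm]

lemma weakIntegrand_massFlux (φ : ℝ → Space N → ℝ) (t : ℝ) (x : Space N) :
    weakIntegrand ρ (massFlux ρ u) φ t x = ρ t x * stDeriv φ t x (1, u t x) := by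
  rw [stDeriv_one_apply, ← sum_smul_stDeriv_unitVec φ t x (u t x), mul_add, Finset.mul_sum]
  simp only [weakIntegrand, massFlux, inner_eq_mul, smul_eq_mul, mul_assoc]

lemma weakIntegrand_momentumFlux (φ : ℝ → Space N → Space N) (t : ℝ) (x : Space N) :
    weakIntegrand (momentumDensity ρ u) (momentumFlux p ρ u) φ t x
      = ρ t x * ⟪u t x, stDeriv φ t x (1, u t x)⟫ + p (ρ t x) * spaceDiv (stDeriv φ t x) := by
  have hunit : ∀ (v : Space N) j, ⟪unitVec j, v⟫ = v j := fun v j => by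
    rw [real_inner_comm, inner_unitVec]
  rw [stDeriv_one_apply, ← sum_smul_stDeriv_unitVec φ t x (u t x), spaceDiv, inner_add_right,
    inner_sum, mul_add, Finset.mul_sum, Finset.mul_sum, add_assoc, ← Finset.sum_add_distrib]
  simp only [weakIntegrand, momentumDensity, momentumFlux, inner_add_left, real_inner_smul_left,
    real_inner_smul_right, hunit, mul_assoc]

lemma weakIntegrand_massFlux_eq_deriv {φ : ℝ → Space N → ℝ} {t : ℝ} {x : Space N}
    (hφ : DifferentiableAt ℝ (Function.uncurry φ) (t, x)) :
    weakIntegrand ρ (massFlux ρ u) φ t x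
      = ρ t x * deriv (fun s => φ s x) t + ρ t x * fderiv ℝ (φ t) x (u t x) := by
  rw [(hasDerivAt_slice hφ).deriv, fderiv_slice_apply hφ, weakIntegrand_massFlux,
    stDeriv_one_apply, mul_add]

lemma weakIntegrand_momentumFlux_eq_deriv {φ : ℝ → Space N → Space N} {t : ℝ} {x : Space N}
    (hφ : DifferentiableAt ℝ (Function.uncurry φ) (t, x)) :
    weakIntegrand (momentumDensity ρ u) (momentumFlux p ρ u) φ t x
      = ⟪ρ t x • u t x, deriv (fun s => φ s x) t⟫
        + ρ t x * ⟪u t x, fderiv ℝ (φ t) x (u t x)⟫ + p (ρ t x) * divergence (φ t) x := by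
  rw [(hasDerivAt_slice hφ).deriv, fderiv_slice_apply hφ, divergence_slice hφ,
    weakIntegrand_momentumFlux, stDeriv_one_apply, inner_add_right, real_inner_smul_left, mul_add]

lemma massFlux_glueAt (ρ₁ ρ₂ : ℝ → Space N → ℝ) (u₁ u₂ : ℝ → Space N → Space N) (j : Fin N) :
    massFlux (glueAt b ρ₁ ρ₂) (glueAt b u₁ u₂) j
      = glueAt b (massFlux ρ₁ u₁ j) (massFlux ρ₂ u₂ j) := by
  ext t x
  simp only [massFlux, glueAt]
  split_ifs <;> rfl

lemma momentumDensity_glueAt (ρ₁ ρ₂ : ℝ → Space N → ℝ) (u₁ u₂ : ℝ → Space N → Space N) :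
    momentumDensity (glueAt b ρ₁ ρ₂) (glueAt b u₁ u₂)
      = glueAt b (momentumDensity ρ₁ u₁) (momentumDensity ρ₂ u₂) := by
  funext t x
  simp only [momentumDensity, glueAt]
  split_ifs <;> rfl

lemma momentumFlux_glueAt (ρ₁ ρ₂ : ℝ → Space N → ℝ) (u₁ u₂ : ℝ → Space N → Space N) (j : Fin N) :
    momentumFlux p (glueAt b ρ₁ ρ₂) (glueAt b u₁ u₂) j
      = glueAt b (momentumFlux p ρ₁ u₁ j) (momentumFlux p ρ₂ u₂ j) := by
  funext t x
  simp only [momentumFlux, glueAt]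
  split_ifs <;> rfl

/-- Measurable states with nonnegative density that are bounded on the cell at all times, instead
of only almost everywhere. -/
structure IsBoundedState (C : ℝ) (ρ : ℝ → Space N → ℝ) (u : ℝ → Space N → Space N) : Prop where
  measurable_density : Measurable (Function.uncurry ρ)
  measurable_velocity : Measurable (Function.uncurry u)
  nonneg : ∀ t x, 0 ≤ ρ t x
  le : ∀ t, ∀ x ∈ cell N, ρ t x ≤ C
  norm_le : ∀ t, ∀ x ∈ cell N, ‖u t x‖ ≤ C

namespace IsBoundedState

lemma isBoundedField_mass (h : IsBoundedState C ρ u) :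
    IsBoundedField a b ρ (massFlux ρ u) where
  measurable_density := h.measurable_density
  measurable_flux j := h.measurable_density.mul ((measurable_pi_apply j).comp
    ((WithLp.measurable_ofLp 2 _).comp h.measurable_velocity))
  bounded := by
    refine ⟨max C (C * C), fun t _ x hx => ?_⟩
    have hρ : ‖ρ t x‖ ≤ C := by
      simpa only [Real.norm_of_nonneg (h.nonneg t x)] using h.le t x hx
    refine ⟨le_max_of_le_left hρ, fun j => le_max_of_le_right ?_⟩
    exact (norm_mul_le _ _).trans (mul_le_mul hρ ((PiLp.norm_apply_le _ j).trans
      (h.norm_le t x hx)) (norm_nonneg _) ((norm_nonneg _).trans hρ))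

lemma isBoundedField_momentum (h : IsBoundedState C ρ u) (hp : ContinuousOn p (Ici 0)) :
    IsBoundedField a b (momentumDensity ρ u) (momentumFlux p ρ u) where
  measurable_density := h.measurable_density.smul h.measurable_velocity
  measurable_flux j := ((h.isBoundedField_mass (a := a) (b := b)).measurable_flux j |>.smul
    h.measurable_velocity).add ((measurable_comp_of_continuousOn_Ici hp h.measurable_density
      fun z => h.nonneg z.1 z.2).smul_const (unitVec j))
  bounded := by
    obtain ⟨K, hK⟩ := (h.isBoundedField_mass (a := a) (b := b)).bounded
    obtain ⟨M, hM⟩ := exists_abs_le_of_continuousOn_Ici hp C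
    refine ⟨max (K * C) (K * C + M), fun t ht x hx => ?_⟩
    obtain ⟨hρ, hρu⟩ := hK t ht x hx
    have hu := h.norm_le t x hx
    have hsmul : ∀ {r : ℝ}, ‖r‖ ≤ K → ‖r • u t x‖ ≤ K * C := fun hr =>
      (norm_smul_le _ _).trans (mul_le_mul hr hu (norm_nonneg _) ((norm_nonneg _).trans hr))
    refine ⟨le_max_of_le_left (hsmul hρ), fun j => le_max_of_le_right ?_⟩
    refine (norm_add_le _ _).trans (add_le_add (hsmul (hρu j)) ?_)
    rw [norm_smul, norm_unitVec, mul_one]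
    exact hM _ (h.nonneg t x) (h.le t x hx)

lemma glue {C₁ C₂ : ℝ} {ρ₁ ρ₂ : ℝ → Space N → ℝ} {u₁ u₂ : ℝ → Space N → Space N}
    (h₁ : IsBoundedState C₁ ρ₁ u₁) (h₂ : IsBoundedState C₂ ρ₂ u₂) :
    IsBoundedState (max C₁ C₂) (glueAt b ρ₁ ρ₂) (glueAt b u₁ u₂) where
  measurable_density := measurable_glueAt h₁.measurable_density h₂.measurable_density
  measurable_velocity := measurable_glueAt h₁.measurable_velocity h₂.measurable_velocity
  nonneg t x := by
    rw [glueAt]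
    split_ifs
    exacts [h₁.nonneg t x, h₂.nonneg t x]
  le t x hx := by
    rw [glueAt]
    split_ifs
    exacts [le_max_of_le_left (h₁.le t x hx), le_max_of_le_right (h₂.le t x hx)]
  norm_le t x hx := by
    rw [glueAt]
    split_ifs
    exacts [le_max_of_le_left (h₁.norm_le t x hx), le_max_of_le_right (h₂.norm_le t x hx)]

end IsBoundedState

lemma exists_isBoundedState_ae_eq {S : Set ℝ} (hρ : Measurable (Function.uncurry ρ))
    (hu : Measurable (Function.uncurry u)) (hC : 0 ≤ C) (hbdd : ∀ t ∈ S, ∀ᵐ x ∂(cellMeasure N),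
      0 ≤ ρ t x ∧ ρ t x ≤ C ∧ ‖u t x‖ ≤ C) :
    ∃ ρ' u', IsBoundedState C ρ' u' ∧
      ∀ t ∈ S, ∀ᵐ x ∂(cellMeasure N), ρ' t x = ρ t x ∧ u' t x = u t x := by
  refine ⟨fun t x => max 0 (min (ρ t x) C), fun t x => if ‖u t x‖ ≤ C then u t x else 0,
    ⟨measurable_const.max (hρ.min measurable_const),
      .ite (measurableSet_le hu.norm measurable_const) hu measurable_const,
      fun t x => le_max_left _ _, fun t x _ => max_le hC (min_le_right _ _), fun t x _ => ?_⟩,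
    fun t ht => ?_⟩
  · split_ifs with hx
    exacts [hx, norm_zero.trans_le hC]
  · filter_upwards [hbdd t ht] with x hx
    exact ⟨by rw [min_eq_left hx.2.1, max_eq_right hx.1], if_pos hx.2.2⟩

/-- Bounded states that solve the Euler system on `[a,b] × Ω` in the weak sense.  In contrast to
`IsWeakSolution`, the time interval is arbitrary and the density may vanish at time `a`. -/
structure IsBoundedSolution (p : ℝ → ℝ) (a b C : ℝ) (ρ : ℝ → Space N → ℝ)
    (u : ℝ → Space N → Space N) : Prop extends IsBoundedState C ρ u where
  mass : IsBalanceLaw a b ρ (massFlux ρ u)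
  momentum : IsBalanceLaw a b (momentumDensity ρ u) (momentumFlux p ρ u)

namespace IsBoundedSolution

lemma mono {d : ℝ} (h : IsBoundedSolution p a b C ρ u) (hac : a ≤ c) (hdb : d ≤ b) :
    IsBoundedSolution p c d C ρ u where
  toIsBoundedState := h.toIsBoundedState
  mass := h.mass.mono hac hdb
  momentum := h.momentum.mono hac hdb

lemma glue {C₁ C₂ : ℝ} {ρ₁ ρ₂ : ℝ → Space N → ℝ} {u₁ u₂ : ℝ → Space N → Space N}
    (h₁ : IsBoundedSolution p a b C₁ ρ₁ u₁) (h₂ : IsBoundedSolution p b c C₂ ρ₂ u₂) (hab : a ≤ b)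
    (hb : ∀ᵐ x ∂(cellMeasure N), ρ₁ b x = ρ₂ b x ∧ u₁ b x = u₂ b x) :
    IsBoundedSolution p a c (max C₁ C₂) (glueAt b ρ₁ ρ₂) (glueAt b u₁ u₂) where
  toIsBoundedState := h₁.toIsBoundedState.glue h₂.toIsBoundedState
  mass := by
    simpa only [← massFlux_glueAt] using h₁.mass.glue h₂.mass hab (hb.mono fun x hx => hx.1)
  momentum := by
    simpa only [← momentumFlux_glueAt, ← momentumDensity_glueAt] using h₁.momentum.glue
      h₂.momentum hab (hb.mono fun x hx => by simp only [momentumDensity, hx.1, hx.2])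

lemma isWeakSolution {T : ℝ} (h : IsBoundedSolution p 0 T C ρ u)
    (h₀ : ∀ᵐ x ∂(cellMeasure N), 0 < ρ 0 x) : IsWeakSolution p T ρ u where
  measurable_density := h.measurable_density
  measurable_velocity := h.measurable_velocity
  bounded := ⟨C, fun t _ => (ae_mem_cell N).mono fun x hx =>
    ⟨h.nonneg t x, h.le t x hx, h.norm_le t x hx⟩⟩
  initial_pos := h₀
  continuity φ hφ τ hτ := by
    have hweak := (h.mass.balance_iff_iterated (.of_isTest hφ) hτ).1 (h.mass.balance φ hφ τ hτ)
    simpa only [weakIntegrand_massFlux_eq_deriv (hφ.smooth.differentiable (by simp) _),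
      inner_eq_mul] using hweak
  momentum φ hφ τ hτ := by
    have hweak := (h.momentum.balance_iff_iterated (.of_isTest hφ) hτ).1
      (h.momentum.balance φ hφ τ hτ)
    simpa only [weakIntegrand_momentumFlux_eq_deriv (hφ.smooth.differentiable (by simp) _),
      momentumDensity] using hweak

end IsBoundedSolution

lemma IsWeakSolution.exists_isBoundedSolution {T : ℝ} (h : IsWeakSolution p T ρ u)
    (hp : ContinuousOn p (Ici 0)) :
    ∃ C ρ' u', IsBoundedSolution p 0 T C ρ' u' ∧
      ∀ t ∈ Icc 0 T, ∀ᵐ x ∂(cellMeasure N), ρ' t x = ρ t x ∧ u' t x = u t x := by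
  obtain ⟨C, hC⟩ := h.bounded
  obtain ⟨ρ', u', hst, heq⟩ := exists_isBoundedState_ae_eq h.measurable_density
    h.measurable_velocity (le_max_right C 0) fun t ht => (hC t ht).mono fun x hx =>
      ⟨hx.1, le_max_of_le_left hx.2.1, le_max_of_le_left hx.2.2⟩
  have heq_uIcc : ∀ {τ}, τ ∈ Icc 0 T → ∀ t ∈ uIcc 0 τ,
      ∀ᵐ x ∂(cellMeasure N), ρ' t x = ρ t x ∧ u' t x = u t x := fun hτ t ht =>
    heq t ((uIcc_of_le hτ.1 ▸ Icc_subset_Icc_right hτ.2 : uIcc _ _ ⊆ Icc 0 T) ht)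
  refine ⟨max C 0, ρ', u', ⟨hst, ⟨hst.isBoundedField_mass, fun φ hφ τ hτ =>
    (hst.isBoundedField_mass.balance_iff_iterated (.of_isTest hφ) hτ).2 ?_⟩,
    ⟨hst.isBoundedField_momentum hp, fun φ hφ τ hτ =>
      ((hst.isBoundedField_momentum hp).balance_iff_iterated (.of_isTest hφ) hτ).2 ?_⟩⟩, heq⟩
  · have hdφ := hφ.smooth.differentiable (by simp)
    convert h.continuity φ hφ τ hτ using 1
    · refine integral_congr_ae ?_
      filter_upwards [heq τ hτ, heq_uIcc hτ 0 left_mem_uIcc] with x hx hx₀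
      rw [inner_eq_mul, inner_eq_mul, hx.1, hx₀.1]
    · refine intervalIntegral.integral_congr fun t ht => integral_congr_ae ?_
      filter_upwards [heq_uIcc hτ t ht] with x hx
      rw [weakIntegrand_massFlux_eq_deriv (hdφ _), hx.1, hx.2]
  · have hdφ := hφ.smooth.differentiable (by simp)
    convert h.momentum φ hφ τ hτ using 1
    · refine integral_congr_ae ?_
      filter_upwards [heq τ hτ, heq_uIcc hτ 0 left_mem_uIcc] with x hx hx₀
      rw [momentumDensity, momentumDensity, hx.1, hx₀.1, hx.2, hx₀.2]
    · refine intervalIntegral.integral_congr fun t ht => integral_congr_ae ?_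
      filter_upwards [heq_uIcc hτ t ht] with x hx
      rw [weakIntegrand_momentumFlux_eq_deriv (hdφ _), hx.1, hx.2]

end EulerFluxes

/-! ### Smooth solutions -/

section Calculus

variable {N : ℕ} {F : Type*} [NormedAddCommGroup F] [NormedSpace ℝ F] {t : ℝ} {x : Space N}
  {f : ℝ → Space N → ℝ} {g g' : ℝ → Space N → F} {V : ℝ → Space N → Space N}

lemma stDeriv_add (hg : DifferentiableAt ℝ (Function.uncurry g) (t, x))
    (hg' : DifferentiableAt ℝ (Function.uncurry g') (t, x)) :
    stDeriv (fun t x => g t x + g' t x) t x = stDeriv g t x + stDeriv g' t x :=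
  fderiv_add hg hg'

lemma stDeriv_smul_apply (hf : DifferentiableAt ℝ (Function.uncurry f) (t, x))
    (hg : DifferentiableAt ℝ (Function.uncurry g) (t, x)) (v : ℝ × Space N) :
    stDeriv (fun t x => f t x • g t x) t x v
      = f t x • stDeriv g t x v + stDeriv f t x v • g t x :=
  DFunLike.congr_fun (fderiv_smul hf hg) v

lemma stDeriv_component_apply (hV : DifferentiableAt ℝ (Function.uncurry V) (t, x)) (j : Fin N)
    (v : ℝ × Space N) : stDeriv (fun t x => V t x j) t x v = stDeriv V t x v j :=
  DFunLike.congr_fun ((EuclideanSpace.proj (𝕜 := ℝ) j).hasFDerivAt.comp (t, x)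
    hV.hasFDerivAt).fderiv v

lemma stDeriv_comp_apply {q : ℝ → F} {q' : F} (hq : HasDerivAt q q' (f t x))
    (hf : DifferentiableAt ℝ (Function.uncurry f) (t, x)) (v : ℝ × Space N) :
    stDeriv (fun t x => q (f t x)) t x v = stDeriv f t x v • q' :=
  DFunLike.congr_fun (HasFDerivAt.comp (f := Function.uncurry f) (t, x) hq.hasFDerivAt
    hf.hasFDerivAt).fderiv v

lemma gradient_eq_sum (f : Space N → ℝ) (x : Space N) :
    gradient f x = ∑ j, fderiv ℝ f x (unitVec j) • unitVec j := by
  have hbasis := (EuclideanSpace.basisFun (Fin N) ℝ).sum_repr' (gradient f x)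
  simp only [EuclideanSpace.basisFun_apply] at hbasis
  rw [← hbasis]
  refine Finset.sum_congr rfl fun j _ => ?_
  rw [real_inner_comm, inner_gradient_left]
  rfl

end Calculus

section SmoothSolution

variable {N : ℕ} {p : ℝ → ℝ} {a b t : ℝ} {r : ℝ → Space N → ℝ} {U : ℝ → Space N → Space N}

lemma IsPressure.hasDerivAt (hp : IsPressure p) {z : ℝ} (hz : 0 < z) :
    HasDerivAt p (deriv p z) z :=
  ((hp.contDiffOn.contDiffAt (Ioi_mem_nhds hz)).differentiableAt one_ne_zero).hasDerivAt

lemma IsC1Periodic.component (hU : IsC1Periodic a b U) (j : Fin N) :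
    IsC1Periodic a b fun t x => U t x j :=
  hU.comp (s := univ) (EuclideanSpace.proj (𝕜 := ℝ) j).contDiff.contDiffOn fun _ _ _ => trivial

lemma IsC1Periodic.massFlux (hr : IsC1Periodic a b r) (hU : IsC1Periodic a b U) (j : Fin N) :
    IsC1Periodic a b (massFlux r U j) :=
  hr.smul (hU.component j)

namespace IsSmoothSolution

lemma isC1Periodic_density (h : IsSmoothSolution p a b r U) : IsC1Periodic a b r :=
  ⟨h.contDiffOn_density, h.periodic_density⟩

lemma isC1Periodic_velocity (h : IsSmoothSolution p a b r U) : IsC1Periodic a b U :=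
  ⟨h.contDiffOn_velocity, h.periodic_velocity⟩

lemma isC1Periodic_pressure (hp : IsPressure p) (h : IsSmoothSolution p a b r U) :
    IsC1Periodic a b fun t x => p (r t x) :=
  h.isC1Periodic_density.comp hp.contDiffOn h.density_pos

lemma isC1Periodic_momentumFlux (hp : IsPressure p) (h : IsSmoothSolution p a b r U)
    (j : Fin N) : IsC1Periodic a b (momentumFlux p r U j) :=
  ((h.isC1Periodic_density.massFlux h.isC1Periodic_velocity j).smul h.isC1Periodic_velocity).add
    (h.isC1Periodic_density.comp (hp.contDiffOn.smul contDiffOn_const) h.density_pos)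

lemma mass_law (h : IsSmoothSolution p a b r U) (ht : t ∈ Ioo a b) (x : Space N) :
    stDeriv r t x (1, 0) + ∑ j, stDeriv (massFlux r U j) t x (0, unitVec j) = 0 := by
  have hr := h.isC1Periodic_density.differentiableAt ht x
  have hrU := (h.isC1Periodic_density.smul h.isC1Periodic_velocity).differentiableAt ht x
  have hcont := h.continuity t ht x
  rw [(hasDerivAt_slice hr).deriv, divergence_slice hrU, spaceDiv] at hcont
  refine Eq.trans ?_ hcont
  congr 1
  exact Finset.sum_congr rfl fun j _ => stDeriv_component_apply hrU j _

lemma stDeriv_momentumFlux_apply (hp : IsPressure p) (h : IsSmoothSolution p a b r U)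
    (ht : t ∈ Ioo a b) (x : Space N) (j : Fin N) (v : ℝ × Space N) :
    stDeriv (momentumFlux p r U j) t x v
      = stDeriv (fun t x => massFlux r U j t x • U t x) t x v
        + stDeriv (fun t x => p (r t x)) t x v • unitVec j := by
  have hr := h.isC1Periodic_density
  have hpos := h.density_pos t (Ioo_subset_Icc_self ht) x
  rw [stDeriv_comp_apply (hp.hasDerivAt hpos) (hr.differentiableAt ht x), smul_assoc,
    ← stDeriv_comp_apply ((hp.hasDerivAt hpos).smul_const (unitVec j : Space N))
      (hr.differentiableAt ht x)]
  exact DFunLike.congr_fun (stDeriv_add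
    (((hr.massFlux h.isC1Periodic_velocity j).smul h.isC1Periodic_velocity).differentiableAt ht x)
    ((hr.comp (hp.contDiffOn.smul contDiffOn_const) h.density_pos).differentiableAt ht x)) v

lemma momentum_law (hp : IsPressure p) (h : IsSmoothSolution p a b r U) (ht : t ∈ Ioo a b)
    (x : Space N) :
    stDeriv (momentumDensity r U) t x (1, 0)
      + ∑ j, stDeriv (momentumFlux p r U j) t x (0, unitVec j) = 0 := by
  have hr := h.isC1Periodic_density
  have hU := h.isC1Periodic_velocity
  have hflux := fun j => ((hr.massFlux hU j).smul hU).differentiableAt ht x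
  have hmom := h.momentum t ht x
  rw [(hasDerivAt_slice ((hr.smul hU).differentiableAt ht x)).deriv, momentumFluxDiv,
    gradient_eq_sum, add_assoc, ← Finset.sum_add_distrib] at hmom
  refine Eq.trans ?_ hmom
  congr 1
  refine Finset.sum_congr rfl fun j _ => ?_
  rw [h.stDeriv_momentumFlux_apply hp ht, ← fderiv_slice_apply (hflux j),
    ← fderiv_slice_apply ((h.isC1Periodic_pressure hp).differentiableAt ht x)]
  rfl

lemma stDeriv_density_transport (h : IsSmoothSolution p a b r U) (ht : t ∈ Ioo a b)
    (x : Space N) :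
    stDeriv r t x (1, U t x) = -(r t x * spaceDiv (stDeriv U t x)) := by
  have hr := h.isC1Periodic_density.differentiableAt ht x
  have hU := h.isC1Periodic_velocity.differentiableAt ht x
  have hUj := fun j => (h.isC1Periodic_velocity.component j).differentiableAt ht x
  have hflux : ∀ j, stDeriv (massFlux r U j) t x (0, unitVec j)
      = r t x * stDeriv U t x (0, unitVec j) j + U t x j • stDeriv r t x (0, unitVec j) :=
    fun j => by
      rw [smul_eq_mul, mul_comm (U t x j), ← stDeriv_component_apply hU]
      exact stDeriv_smul_apply hr (hUj j) _
  have hlaw := h.mass_law ht x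
  simp only [hflux, Finset.sum_add_distrib, ← Finset.mul_sum, sum_smul_stDeriv_unitVec] at hlaw
  rw [stDeriv_one_apply, spaceDiv]
  linarith

lemma stDeriv_velocity_transport (hp : IsPressure p) (h : IsSmoothSolution p a b r U)
    (ht : t ∈ Ioo a b) (x v : Space N) :
    r t x * ⟪stDeriv U t x (1, U t x), v⟫ = -(deriv p (r t x) * stDeriv r t x (0, v)) := by
  have hr := h.isC1Periodic_density
  have hU := h.isC1Periodic_velocity
  have hpos := h.density_pos t (Ioo_subset_Icc_self ht) x
  have hlaw := congrArg (fun w => ⟪w, v⟫) (h.momentum_law hp ht x)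
  have hmass := h.mass_law ht x
  have hdensity : stDeriv (momentumDensity r U) t x (1, 0)
      = r t x • stDeriv U t x (1, 0) + stDeriv r t x (1, 0) • U t x :=
    stDeriv_smul_apply (hr.differentiableAt ht x) (hU.differentiableAt ht x) _
  have hflux : ∀ j, ⟪stDeriv (momentumFlux p r U j) t x (0, unitVec j), v⟫
      = r t x * (U t x j • ⟪stDeriv U t x (0, unitVec j), v⟫)
        + stDeriv (massFlux r U j) t x (0, unitVec j) * ⟪U t x, v⟫
        + deriv p (r t x) * (v j • stDeriv r t x (0, unitVec j)) := fun j => by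
    rw [h.stDeriv_momentumFlux_apply hp ht, stDeriv_smul_apply ((hr.massFlux hU j).differentiableAt
      ht x) (hU.differentiableAt ht x), stDeriv_comp_apply (hp.hasDerivAt hpos)
      (hr.differentiableAt ht x), inner_add_left, inner_add_left, real_inner_smul_left,
      real_inner_smul_left, real_inner_smul_left, real_inner_comm v (unitVec j), inner_unitVec,
      massFlux, smul_eq_mul, smul_eq_mul, smul_eq_mul]
    ring
  have hconv : ∑ j, U t x j • ⟪stDeriv U t x (0, unitVec j), v⟫
      = ⟪stDeriv U t x (0, U t x), v⟫ := by
    simp only [← sum_smul_stDeriv_unitVec U t x (U t x), sum_inner, real_inner_smul_left,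
      smul_eq_mul]
  simp only [inner_add_left, sum_inner, hflux, hdensity, real_inner_smul_left,
    Finset.sum_add_distrib, ← Finset.mul_sum, ← Finset.sum_mul, sum_smul_stDeriv_unitVec, hconv,
    inner_zero_left] at hlaw
  rw [stDeriv_one_apply, inner_add_left]
  linear_combination hlaw - ⟪U t x, v⟫ * hmass

lemma exists_isBoundedSolution_clampTime (hp : IsPressure p) (h : IsSmoothSolution p a b r U)
    (hab : a ≤ b) : ∃ C, IsBoundedSolution p a b C (clampTime a b r) (clampTime a b U) := by
  have hr := h.isC1Periodic_density
  have hU := h.isC1Periodic_velocity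
  obtain ⟨C, hC⟩ := hr.exists_norm_le
  obtain ⟨K, hK⟩ := hU.exists_norm_le
  have hclamp := max_min_mem_Icc hab
  exact ⟨max C K, {
    measurable_density := (hr.continuous_clampTime hab).measurable
    measurable_velocity := (hU.continuous_clampTime hab).measurable
    nonneg := fun t x => (h.density_pos _ (hclamp t) x).le
    le := fun t x hx => le_max_of_le_left ((le_abs_self _).trans (hC _ (hclamp t) x hx))
    norm_le := fun t x hx => le_max_of_le_right (hK _ (hclamp t) x hx)
    mass := hr.isBalanceLaw_clampTime hab (hr.massFlux hU) fun _ => h.mass_law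
    momentum := IsC1Periodic.isBalanceLaw_clampTime hab (hr.smul hU)
      (h.isC1Periodic_momentumFlux hp) fun _ => h.momentum_law hp }⟩

end IsSmoothSolution

end SmoothSolution

/-! ### The pressure potential -/

lemma le_of_monotoneOn_deriv {G g : ℝ → ℝ} {r x y : ℝ} (hx : x ∈ uIcc r y)
    (hG : ∀ z ∈ uIcc r y, HasDerivAt G (g z) z) (hg : MonotoneOn g (uIcc r y))
    (hr : g r = 0) : G x ≤ G y := by
  have hcont : ContinuousOn G (uIcc r y) := fun z hz => (hG z hz).continuousAt.continuousWithinAt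
  have hdiff : DifferentiableOn ℝ G (interior (uIcc r y)) := fun z hz =>
    (hG z (interior_subset hz)).differentiableAt.differentiableWithinAt
  have hderiv : ∀ z ∈ interior (uIcc r y), deriv G z = g z := fun z hz =>
    (hG z (interior_subset hz)).deriv
  rcases le_total r y with h | h
  · have hmono : MonotoneOn G (uIcc r y) :=
      monotoneOn_of_deriv_nonneg (convex_uIcc r y) hcont hdiff fun z hz => by
        rw [hderiv z hz, ← hr]
        exact hg left_mem_uIcc (interior_subset hz)
          (uIcc_of_le h ▸ interior_subset hz : z ∈ Icc r y).1
    exact hmono hx right_mem_uIcc (uIcc_of_le h ▸ hx : x ∈ Icc r y).2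
  · have hanti : AntitoneOn G (uIcc r y) :=
      antitoneOn_of_deriv_nonpos (convex_uIcc r y) hcont hdiff fun z hz => by
        rw [hderiv z hz, ← hr]
        exact hg (interior_subset hz) left_mem_uIcc
          (uIcc_of_ge h ▸ interior_subset hz : z ∈ Icc y r).2
    exact hanti right_mem_uIcc hx (uIcc_of_ge h ▸ hx : x ∈ Icc y r).1

lemma abs_sub_sub_mul_le_of_lipschitz_deriv {f f' : ℝ → ℝ} {x r K : ℝ} (hK : 0 ≤ K)
    (hf : ∀ z ∈ uIcc r x, HasDerivAt f (f' z) z)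
    (hlip : ∀ z ∈ uIcc r x, |f' z - f' r| ≤ K * |z - r|) :
    |f x - f r - f' r * (x - r)| ≤ K * (x - r) ^ 2 := by
  have hderiv : ∀ z ∈ uIcc r x,
      HasDerivWithinAt (fun z => f z - f' r * z) (f' z - f' r) (uIcc r x) z := fun z hz =>
    (((hf z hz).sub ((hasDerivAt_id z).const_mul (f' r))).congr_deriv
      (by rw [mul_one])).hasDerivWithinAt
  have hbound : ∀ z ∈ uIcc r x, ‖f' z - f' r‖ ≤ K * |x - r| := fun z hz =>
    (hlip z hz).trans (mul_le_mul_of_nonneg_left (abs_sub_left_of_mem_uIcc hz) hK)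
  have hmvt := (convex_uIcc r x).norm_image_sub_le_of_norm_hasDerivWithin_le hderiv hbound
    left_mem_uIcc right_mem_uIcc
  rw [Real.norm_eq_abs, Real.norm_eq_abs, mul_assoc, ← sq, sq_abs] at hmvt
  convert hmvt using 2
  ring

lemma uIcc_subset_Ioi {a b c : ℝ} (ha : c < a) (hb : c < b) : uIcc a b ⊆ Ioi c :=
  fun _ hz => (lt_min ha hb).trans_le hz.1

section Pressure

variable {p : ℝ → ℝ}

/-- The derivative `P'` of the pressure potential. -/
noncomputable def potentialDeriv (p : ℝ → ℝ) (z : ℝ) : ℝ :=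
  (∫ w in (1 : ℝ)..z, p w / w ^ 2) + p z / z

/-- The relative pressure potential `P(z) - P(r) - P'(r)(z - r)`, the Bregman distance of the
convex function `P`. -/
noncomputable def relPotential (p : ℝ → ℝ) (z r : ℝ) : ℝ :=
  pressurePotential p z - pressurePotential p r - potentialDeriv p r * (z - r)

lemma pressurePotential_zero : pressurePotential p 0 = 0 := zero_mul _

lemma pressurePotential_eq {r : ℝ} (hr : 0 < r) :
    pressurePotential p r = r * potentialDeriv p r - p r := by
  rw [pressurePotential, potentialDeriv]
  field_simp
  ring

lemma relPotential_self (r : ℝ) : relPotential p r r = 0 := by simp [relPotential]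

lemma relPotential_zero {r : ℝ} (hr : 0 < r) : relPotential p 0 r = p r := by
  rw [relPotential, pressurePotential_zero, pressurePotential_eq hr]
  ring

namespace IsPressure

lemma continuousOn_deriv (hp : IsPressure p) : ContinuousOn (deriv p) (Ioi 0) :=
  hp.contDiffOn.continuousOn_deriv_of_isOpen isOpen_Ioi le_rfl

lemma strictMonoOn (hp : IsPressure p) : StrictMonoOn p (Ici 0) :=
  strictMonoOn_of_deriv_pos (convex_Ici 0) hp.continuousOn fun z hz => by
    rw [interior_Ici] at hz
    exact hp.deriv_pos z hz

lemma pos (hp : IsPressure p) {z : ℝ} (hz : 0 < z) : 0 < p z :=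
  hp.map_zero ▸ hp.strictMonoOn self_mem_Ici hz.le hz

lemma hasDerivAt_integral (hp : IsPressure p) {z : ℝ} (hz : 0 < z) :
    HasDerivAt (fun z => ∫ w in (1 : ℝ)..z, p w / w ^ 2) (p z / z ^ 2) z := by
  have hcont : ContinuousOn (fun w => p w / w ^ 2) (Ioi 0) :=
    (hp.continuousOn.mono Ioi_subset_Ici_self).div (by fun_prop) fun w hw =>
      pow_ne_zero 2 (ne_of_gt hw)
  exact intervalIntegral.integral_hasDerivAt_right
    (hcont.mono (uIcc_subset_Ioi one_pos hz)).intervalIntegrable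
    (hcont.stronglyMeasurableAtFilter isOpen_Ioi z hz) (hcont.continuousAt (Ioi_mem_nhds hz))

lemma hasDerivAt_potential (hp : IsPressure p) {z : ℝ} (hz : 0 < z) :
    HasDerivAt (pressurePotential p) (potentialDeriv p z) z := by
  refine ((hasDerivAt_id z).mul (hp.hasDerivAt_integral hz)).congr_deriv ?_
  simp only [potentialDeriv, id]
  field_simp

lemma hasDerivAt_potentialDeriv (hp : IsPressure p) {z : ℝ} (hz : 0 < z) :
    HasDerivAt (potentialDeriv p) (deriv p z / z) z := by
  refine ((hp.hasDerivAt_integral hz).add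
    ((hp.hasDerivAt hz).div (hasDerivAt_id z) hz.ne')).congr_deriv ?_
  simp only [id]
  field_simp
  ring

lemma contDiffOn_potentialDeriv (hp : IsPressure p) :
    ContDiffOn ℝ 1 (potentialDeriv p) (Ioi 0) := by
  rw [show (1 : WithTop ℕ∞) = 0 + 1 from (zero_add 1).symm,
    contDiffOn_succ_iff_deriv_of_isOpen isOpen_Ioi]
  refine ⟨fun z hz => (hp.hasDerivAt_potentialDeriv hz).differentiableAt.differentiableWithinAt,
    by simp, contDiffOn_zero.2 ?_⟩
  exact (hp.continuousOn_deriv.div continuousOn_id fun z hz => ne_of_gt hz).congr fun z hz =>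
    (hp.hasDerivAt_potentialDeriv hz).deriv

lemma monotoneOn_potentialDeriv_sub (hp : IsPressure p) {m : ℝ} {s : Set ℝ} (hs : Convex ℝ s)
    (hpos : s ⊆ Ioi 0) (hm : ∀ z ∈ s, m * z ≤ deriv p z) :
    MonotoneOn (fun z => potentialDeriv p z - m * z) s := by
  have hd : ∀ z ∈ s, HasDerivAt (fun z => potentialDeriv p z - m * z) (deriv p z / z - m) z :=
    fun z hz => ((hp.hasDerivAt_potentialDeriv (hpos hz)).sub
      ((hasDerivAt_id z).const_mul m)).congr_deriv (by rw [mul_one])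
  refine monotoneOn_of_deriv_nonneg hs (fun z hz => (hd z hz).continuousAt.continuousWithinAt)
    (fun z hz => (hd z (interior_subset hz)).differentiableAt.differentiableWithinAt)
    fun z hz => ?_
  have hzs := interior_subset hz
  rw [(hd z hzs).deriv, sub_nonneg, le_div_iff₀ (hpos hzs)]
  exact hm z hzs

lemma relPotential_sub_sq_le (hp : IsPressure p) {m r x y : ℝ} (hr : 0 < r) (hy : 0 < y)
    (hx : x ∈ uIcc r y) (hm : ∀ z ∈ uIcc r y, m * z ≤ deriv p z) :
    relPotential p x r - m / 2 * (x - r) ^ 2 ≤ relPotential p y r - m / 2 * (y - r) ^ 2 := by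
  have hsub := uIcc_subset_Ioi hr hy
  have hmono := hp.monotoneOn_potentialDeriv_sub (convex_uIcc r y) hsub hm
  refine le_of_monotoneOn_deriv
    (G := fun z => relPotential p z r - m / 2 * (z - r) ^ 2)
    (g := fun z => potentialDeriv p z - m * z - (potentialDeriv p r - m * r)) hx
    (fun z hz => ?_) (fun z hz w hw hzw => sub_le_sub_right (hmono hz hw hzw) _) (sub_self _)
  have hrel : HasDerivAt (fun z => relPotential p z r)
      (potentialDeriv p z - potentialDeriv p r) z :=
    (((hp.hasDerivAt_potential (hsub hz)).sub_const (pressurePotential p r)).sub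
      (((hasDerivAt_id z).sub_const r).const_mul (potentialDeriv p r))).congr_deriv
      (by rw [mul_one])
  refine (hrel.sub ((((hasDerivAt_id z).sub_const r).pow 2).const_mul (m / 2))).congr_deriv ?_
  simp only [id]
  ring

lemma relPotential_mono (hp : IsPressure p) {r x y : ℝ} (hr : 0 < r) (hy : 0 < y)
    (hx : x ∈ uIcc r y) : relPotential p x r ≤ relPotential p y r := by
  simpa using hp.relPotential_sub_sq_le (m := 0) hr hy hx fun z hz => by
    simpa using (hp.deriv_pos z (uIcc_subset_Ioi hr hy hz)).le

lemma sq_le_relPotential (hp : IsPressure p) {m r z : ℝ} (hr : 0 < r) (hz : 0 < z)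
    (hm : ∀ w ∈ uIcc r z, m * w ≤ deriv p w) : m / 2 * (z - r) ^ 2 ≤ relPotential p z r := by
  simpa [relPotential_self] using hp.relPotential_sub_sq_le hr hz left_mem_uIcc hm

lemma relPotential_nonneg (hp : IsPressure p) {r z : ℝ} (hr : 0 < r) (hz : 0 ≤ z) :
    0 ≤ relPotential p z r := by
  rcases hz.eq_or_lt with rfl | hz
  · exact relPotential_zero hr ▸ (hp.pos hr).le
  · exact relPotential_self (p := p) r ▸ hp.relPotential_mono hr hz left_mem_uIcc

lemma eq_of_relPotential_eq_zero (hp : IsPressure p) {r z : ℝ} (hr : 0 < r) (hz : 0 ≤ z)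
    (h : relPotential p z r = 0) : z = r := by
  rcases hz.eq_or_lt with rfl | hz
  · exact absurd h (relPotential_zero hr ▸ (hp.pos hr).ne')
  have hsub := uIcc_subset_Ioi hr hz
  obtain ⟨w₀, hw₀, hmin⟩ := isCompact_uIcc.exists_isMinOn nonempty_uIcc
    ((hp.continuousOn_deriv.div continuousOn_id fun w hw => ne_of_gt hw).mono hsub)
  have hm : 0 < deriv p w₀ / w₀ := div_pos (hp.deriv_pos w₀ (hsub hw₀)) (hsub hw₀)
  have hcoer := hp.sq_le_relPotential hr hz fun w hw => (le_div_iff₀ (hsub hw)).1 (hmin hw)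
  rw [h] at hcoer
  exact sub_eq_zero.1 <| pow_eq_zero_iff two_ne_zero |>.1 <|
    le_antisymm (nonpos_of_mul_nonpos_right hcoer (half_pos hm)) (sq_nonneg _)

lemma exists_abs_potential_le (hp : IsPressure p) (C : ℝ) :
    ∃ M, ∀ z, 0 ≤ z → z ≤ C → |pressurePotential p z| ≤ M := by
  have hp1 := hp.pos one_pos
  refine ⟨C * |potentialDeriv p C| + p 1, fun z hz hzC => ?_⟩
  have hC := mul_nonneg (hz.trans hzC) (abs_nonneg (potentialDeriv p C))
  rcases hz.eq_or_lt with rfl | hz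
  · rw [pressurePotential_zero, abs_zero]
    linarith
  have hmono : potentialDeriv p z ≤ potentialDeriv p C := by
    simpa using hp.monotoneOn_potentialDeriv_sub (m := 0) (convex_Ioi 0) subset_rfl
      (fun w hw => by simpa using (hp.deriv_pos w hw).le) hz (hz.trans_le hzC) hzC
  -- `P` lies between its tangent at `1` and the line through the origin with slope `P'(C)`.
  have hlower : p 1 * (z - 1) ≤ pressurePotential p z := by
    simpa [relPotential, pressurePotential, potentialDeriv]
      using hp.relPotential_nonneg one_pos hz.le
  have hupper : pressurePotential p z ≤ C * |potentialDeriv p C| := by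
    rw [pressurePotential_eq hz]
    have hle : z * potentialDeriv p z ≤ C * |potentialDeriv p C| :=
      (mul_le_mul_of_nonneg_left (hmono.trans (le_abs_self _)) hz.le).trans
        (mul_le_mul_of_nonneg_right hzC (abs_nonneg _))
    linarith [hp.pos hz]
  rw [abs_le]
  constructor <;> nlinarith

lemma measurable_potential (hp : IsPressure p) {α : Type*} [MeasurableSpace α]
    {f : α → ℝ} (hf : Measurable f) (h0 : ∀ a, 0 ≤ f a) :
    Measurable fun a => pressurePotential p (f a) := by
  have hm : Measurable ((Ioi (0 : ℝ)).piecewise (pressurePotential p) fun _ => 0) :=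
    ContinuousOn.measurable_piecewise
      (fun z hz => (hp.hasDerivAt_potential hz).continuousAt.continuousWithinAt)
      continuousOn_const measurableSet_Ioi
  convert hm.comp hf using 2 with a
  rcases (h0 a).eq_or_lt with h | h
  · simp [← h, pressurePotential_zero]
  · simp [h]

end IsPressure

/-- The relative pressure `p(z) - p(r) - p'(r)(z - r)`, the part of the remainder in the relative
energy inequality that depends on the densities only. -/
noncomputable def relPressure (p : ℝ → ℝ) (z r : ℝ) : ℝ :=
  p z - p r - deriv p r * (z - r)

namespace IsPressure

lemma abs_relPressure_le_of_lipschitz (hp : IsPressure p) {s : Set ℝ} [OrdConnected s]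
    (hs : s ⊆ Ioi 0) {K m : ℝ} (hK : 0 ≤ K) (hm : 0 < m)
    (hlip : ∀ z ∈ s, ∀ w ∈ s, |deriv p z - deriv p w| ≤ K * |z - w|)
    (hlow : ∀ z ∈ s, m * z ≤ deriv p z) {z r : ℝ} (hz : z ∈ s) (hr : r ∈ s) :
    |relPressure p z r| ≤ 2 * K / m * relPotential p z r := by
  have hsub : uIcc r z ⊆ s := OrdConnected.uIcc_subset ‹_› hr hz
  have htaylor := abs_sub_sub_mul_le_of_lipschitz_deriv hK
    (fun w hw => hp.hasDerivAt (hs (hsub hw))) fun w hw => hlip w (hsub hw) r hr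
  have hcoer := hp.sq_le_relPotential (hs hr) (hs hz) fun w hw => hlow w (hsub hw)
  calc |relPressure p z r| ≤ K * (z - r) ^ 2 := htaylor
    _ = 2 * K / m * (m / 2 * (z - r) ^ 2) := by field_simp
    _ ≤ 2 * K / m * relPotential p z r :=
      mul_le_mul_of_nonneg_left hcoer (by positivity)

lemma le_relPotential_of_notMem_Ioo (hp : IsPressure p) {l v m η r z : ℝ} (hl : 0 < l)
    (hm : 0 ≤ m) (hη : 0 ≤ η) (hlow : ∀ w ∈ Icc l v, m * w ≤ deriv p w) (hlr : l + η ≤ r)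
    (hrv : r + η ≤ v) (hz : 0 ≤ z) (hzlv : z ∉ Ioo l v) :
    min (m / 2 * η ^ 2) (p l) ≤ relPotential p z r := by
  have hr : 0 < r := by linarith
  have hrI : r ∈ Icc l v := ⟨by linarith, by linarith⟩
  have hend : ∀ w ∈ Icc l v, η ≤ |w - r| → m / 2 * η ^ 2 ≤ relPotential p w r :=
    fun w hw hη' => by
      refine le_trans ?_ (hp.sq_le_relPotential hr (hl.trans_le hw.1) fun y hy =>
        hlow y (ordConnected_Icc.uIcc_subset hrI hw hy))
      rw [← sq_abs (w - r)]
      gcongr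
  rcases hz.eq_or_lt with rfl | hz
  · rw [relPotential_zero hr]
    exact (min_le_right _ _).trans (hp.strictMonoOn.monotoneOn hl.le hr.le hrI.1)
  refine (min_le_left _ _).trans ?_
  rcases le_or_gt z l with hzl | hzl
  · refine (hend l ⟨le_rfl, hrI.1.trans hrI.2⟩ ?_).trans
      (hp.relPotential_mono hr hz (mem_uIcc_of_ge hzl hrI.1))
    rw [abs_sub_comm]
    exact (by linarith : η ≤ r - l).trans (le_abs_self _)
  · have hvz : v ≤ z := not_lt.1 fun hzv => hzlv ⟨hzl, hzv⟩
    exact (hend v ⟨hrI.1.trans hrI.2, le_rfl⟩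
      ((by linarith : η ≤ v - r).trans (le_abs_self _))).trans
      (hp.relPotential_mono hr hz (mem_uIcc_of_le hrI.2 hvz))

lemma exists_abs_relPressure_le_const (hp : IsPressure p) {l v : ℝ} (hl : 0 < l) (C : ℝ) :
    ∃ B, ∀ r ∈ Icc l v, ∀ z ∈ Icc 0 C, |relPressure p z r| ≤ B := by
  have hfst : ContinuousOn (fun q : ℝ × ℝ => p q.1) (Icc 0 C ×ˢ Icc l v) :=
    hp.continuousOn.comp continuousOn_fst fun q hq => hq.1.1
  have hsnd : MapsTo Prod.snd (Icc 0 C ×ˢ Icc l v) (Ioi 0) := fun q hq => hl.trans_le hq.2.1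
  have hcont : ContinuousOn (fun q : ℝ × ℝ => relPressure p q.1 q.2)
      (Icc 0 C ×ˢ Icc l v) := by
    have hpr : ContinuousOn (fun q : ℝ × ℝ => p q.2) (Icc 0 C ×ˢ Icc l v) :=
      hp.continuousOn.comp continuousOn_snd (hsnd.mono_right Ioi_subset_Ici_self)
    exact (hfst.sub hpr).sub
      ((hp.continuousOn_deriv.comp continuousOn_snd hsnd).mul (by fun_prop))
  obtain ⟨B, hB⟩ := (isCompact_Icc.prod isCompact_Icc).exists_bound_of_continuousOn hcont
  exact ⟨B, fun r hr z hz => hB (z, r) ⟨hz, hr⟩⟩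

lemma exists_Icc_lipschitz_deriv (hp : IsPressure p) {r₀ : ℝ} (hr₀ : 0 < r₀)
    (hreg : ∃ K, ∃ s ∈ 𝓝 r₀, LipschitzOnWith K (deriv p) s) :
    ∃ δ > 0, δ < r₀ ∧ ∃ K m : ℝ, 0 ≤ K ∧ 0 < m ∧ ∀ z ∈ Icc (r₀ - δ) (r₀ + δ),
      m * z ≤ deriv p z ∧
        ∀ w ∈ Icc (r₀ - δ) (r₀ + δ), |deriv p z - deriv p w| ≤ K * |z - w| := by
  obtain ⟨K, s, hs, hlip⟩ := hreg
  have hd₀ := hp.deriv_pos r₀ hr₀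
  have hlow : ∀ᶠ z in 𝓝 r₀, deriv p r₀ / (2 * r₀) * z < deriv p z := by
    refine ContinuousAt.eventually_lt (by fun_prop)
      (hp.continuousOn_deriv.continuousAt (Ioi_mem_nhds hr₀)) ?_
    field_simp
    linarith
  obtain ⟨δ, hδ, hball⟩ := Metric.nhds_basis_closedBall.mem_iff.1
    (Filter.inter_mem hs (Filter.inter_mem (Ioi_mem_nhds hr₀) hlow))
  rw [Real.closedBall_eq_Icc] at hball
  have hpos : 0 < r₀ - δ := (hball ⟨le_rfl, by linarith⟩).2.1
  exact ⟨δ, hδ, by linarith, K, _, K.2, by positivity, fun z hz => ⟨(hball hz).2.2.le,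
    fun w hw => by simpa [Real.dist_eq] using hlip.dist_le_mul z (hball hz).1 w (hball hw).1⟩⟩

/-- Near the diagonal both sides are quadratic in `z - r`; away from it the left side is bounded
and the right side is bounded below. -/
lemma exists_abs_relPressure_le_nhds (hp : IsPressure p) {r₀ : ℝ} (hr₀ : 0 < r₀)
    (hreg : ∃ K, ∃ s ∈ 𝓝 r₀, LipschitzOnWith K (deriv p) s) (C : ℝ) :
    ∃ c, ∃ s ∈ 𝓝 r₀, ∀ r ∈ s, 0 < r ∧ ∀ z ∈ Icc 0 C,
      |relPressure p z r| ≤ c * relPotential p z r := by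
  obtain ⟨δ, hδ, hδr₀, K, m, hK, hm, hreg⟩ := hp.exists_Icc_lipschitz_deriv hr₀ hreg
  have hl : 0 < r₀ - δ := by linarith
  obtain ⟨B, hB⟩ := hp.exists_abs_relPressure_le_const (v := r₀ + δ) hl C
  set d := min (m / 2 * (δ / 2) ^ 2) (p (r₀ - δ))
  have hd : 0 < d := lt_min (by positivity) (hp.pos hl)
  refine ⟨max (2 * K / m) (|B| / d), Icc (r₀ - δ / 2) (r₀ + δ / 2),
    Icc_mem_nhds (by linarith) (by linarith), fun r hr => ?_⟩
  have hrI : r ∈ Icc (r₀ - δ) (r₀ + δ) := ⟨by linarith [hr.1], by linarith [hr.2]⟩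
  have hrpos : 0 < r := hl.trans_le hrI.1
  refine ⟨hrpos, fun z hz => ?_⟩
  by_cases hzI : z ∈ Ioo (r₀ - δ) (r₀ + δ)
  · exact (hp.abs_relPressure_le_of_lipschitz (fun w hw => hl.trans_le hw.1) hK hm
      (fun w hw => (hreg w hw).2) (fun w hw => (hreg w hw).1) (Ioo_subset_Icc_self hzI) hrI).trans
      (mul_le_mul_of_nonneg_right (le_max_left _ _) (hp.relPotential_nonneg hrpos hz.1))
  · have hfar : d ≤ relPotential p z r :=
      hp.le_relPotential_of_notMem_Ioo hl hm.le (half_pos hδ).le (fun w hw => (hreg w hw).1)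
        (by linarith [hr.1]) (by linarith [hr.2]) hz.1 hzI
    calc |relPressure p z r| ≤ |B| := (hB r hrI z hz).trans (le_abs_self B)
      _ = |B| / d * d := (div_mul_cancel₀ _ hd.ne').symm
      _ ≤ max (2 * K / m) (|B| / d) * relPotential p z r :=
        mul_le_mul (le_max_right _ _) hfar hd.le (le_max_of_le_left (by positivity))

lemma exists_abs_relPressure_le (hp : IsPressure p) {S : Set ℝ} (hS : IsCompact S)
    (hpos : ∀ r ∈ S, 0 < r)
    (hreg : ∀ r ∈ S, ∃ K, ∃ s ∈ 𝓝 r, LipschitzOnWith K (deriv p) s) (C : ℝ) :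
    ∃ c, ∀ r ∈ S, ∀ z ∈ Icc 0 C, |relPressure p z r| ≤ c * relPotential p z r := by
  suffices h : ∃ c, ∀ r ∈ S, 0 < r ∧ ∀ z ∈ Icc 0 C,
      |relPressure p z r| ≤ c * relPotential p z r from h.imp fun c hc r hr => (hc r hr).2
  refine hS.induction_on (p := fun S => ∃ c, ∀ r ∈ S, 0 < r ∧ ∀ z ∈ Icc 0 C,
    |relPressure p z r| ≤ c * relPotential p z r) ⟨0, fun _ => False.elim⟩ ?_ ?_ fun r hr => ?_
  · exact fun _ _ hst ⟨c, hc⟩ => ⟨c, fun r hr => hc r (hst hr)⟩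
  · rintro s t ⟨c, hc⟩ ⟨c', hc'⟩
    have hmax : ∀ {k r}, k ≤ max c c' → (0 < r ∧ ∀ z ∈ Icc 0 C,
        |relPressure p z r| ≤ k * relPotential p z r) → 0 < r ∧ ∀ z ∈ Icc 0 C,
        |relPressure p z r| ≤ max c c' * relPotential p z r := fun hk h =>
      ⟨h.1, fun z hz => (h.2 z hz).trans
        (mul_le_mul_of_nonneg_right hk (hp.relPotential_nonneg h.1 hz.1))⟩
    exact ⟨max c c', fun r hr => hr.elim (fun hr => hmax (le_max_left _ _) (hc r hr))
      fun hr => hmax (le_max_right _ _) (hc' r hr)⟩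
  · obtain ⟨c, s, hs, hc⟩ := hp.exists_abs_relPressure_le_nhds (hpos r hr) (hreg r hr) C
    exact ⟨s, mem_nhdsWithin_of_mem_nhds hs, c, hc⟩

end IsPressure

end Pressure

/-! ### Decay of the energy -/

section WeaklyDecreasing

/-- `E' ≤ 0` on `(a,b)` in the sense of distributions. -/
def IsWeaklyDecreasing (a b : ℝ) (E : ℝ → ℝ) : Prop :=
  ∀ ψ : ℝ → ℝ, ContDiff ℝ ∞ ψ → (∀ t, 0 ≤ ψ t) → ψ a = 0 → (∃ c < b, ∀ t, c ≤ t → ψ t = 0) →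
    0 ≤ ∫ t in a..b, E t * deriv ψ t

lemma hasDerivAt_integral_sub_sub {η : ℝ → ℝ} (hη : Continuous η) (c d y : ℝ) :
    HasDerivAt (fun y => ∫ z in (y - d)..(y - c), η z) (η (y - c) - η (y - d)) y := by
  have hprim : ∀ x, HasDerivAt (fun x => ∫ z in (0 : ℝ)..x, η z) (η x) x := fun x =>
    hη.integral_hasStrictDerivAt 0 x |>.hasDerivAt
  exact (((hprim _).comp_sub_const y c).sub ((hprim _).comp_sub_const y d)).congr_of_eventuallyEq
    (.of_forall fun y => (intervalIntegral.integral_interval_sub_left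
      (hη.intervalIntegrable 0 _) (hη.intervalIntegrable 0 _)).symm)

lemma deriv_integral_sub_sub {η : ℝ → ℝ} (hη : Continuous η) (c d : ℝ) :
    deriv (fun y => ∫ z in (y - d)..(y - c), η z) = fun y => η (y - c) - η (y - d) :=
  funext fun y => (hasDerivAt_integral_sub_sub hη c d y).deriv

lemma contDiff_integral_sub_sub {η : ℝ → ℝ} (hη : ContDiff ℝ ∞ η) (c d : ℝ) :
    ContDiff ℝ ∞ fun y => ∫ z in (y - d)..(y - c), η z := by
  refine contDiff_infty_iff_deriv.2 ⟨fun y =>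
    (hasDerivAt_integral_sub_sub hη.continuous c d y).differentiableAt, ?_⟩
  rw [deriv_integral_sub_sub hη.continuous]
  fun_prop

lemma normed_shrinkingBump_eq_zero {n : ℕ} {z : ℝ} (h : (shrinkingBump ℝ n).rOut ≤ |z|) :
    (shrinkingBump ℝ n).normed volume z = 0 := by
  rwa [← Function.notMem_support, ContDiffBump.support_normed_eq, Metric.mem_ball,
    dist_zero_right, Real.norm_eq_abs, not_lt]

lemma normed_shrinkingBump_sub_comm (n : ℕ) (x y : ℝ) :
    (shrinkingBump ℝ n).normed volume (x - y) = (shrinkingBump ℝ n).normed volume (y - x) := by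
  rw [← neg_sub, ContDiffBump.normed_neg]

lemma mollify_eq_integral_mul (f : ℝ → ℝ) (n : ℕ) (x : ℝ) :
    mollify volume n f x = ∫ y, (shrinkingBump ℝ n).normed volume (y - x) * f y := by
  rw [mollify_apply, ← integral_sub_left_eq_self _ volume x]
  simp only [smul_eq_mul, sub_sub_cancel, normed_shrinkingBump_sub_comm n x]

lemma integrable_normed_sub_mul {f : ℝ → ℝ} (hf : LocallyIntegrable f volume) (n : ℕ) (x : ℝ) :
    Integrable fun y => (shrinkingBump ℝ n).normed volume (y - x) * f y := by
  simpa only [smul_eq_mul, sub_sub_cancel, normed_shrinkingBump_sub_comm n x] using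
    (integrable_normed_smul_comp_sub (n := n) hf x).comp_sub_left x

namespace IsWeaklyDecreasing

variable {E : ℝ → ℝ} {a b : ℝ}

lemma mollify_le_mollify (hE : IsWeaklyDecreasing a b E) (hint : IntegrableOn E (Ioc a b)) {n : ℕ}
    {c d : ℝ} (hac : a + (shrinkingBump ℝ n).rOut ≤ c) (hcd : c ≤ d)
    (hdb : d + (shrinkingBump ℝ n).rOut < b) :
    mollify volume n ((Ioc a b).indicator E) d ≤ mollify volume n ((Ioc a b).indicator E) c := by
  set η := (shrinkingBump ℝ n).normed volume with hη
  have hsmooth : ContDiff ℝ ∞ η := (shrinkingBump ℝ n).contDiff_normed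
  have hvanish : ∀ y, (∀ z ∈ Icc (y - d) (y - c), (shrinkingBump ℝ n).rOut ≤ |z|) →
      ∫ z in (y - d)..(y - c), η z = 0 := fun y hy => by
    rw [intervalIntegral.integral_congr (g := fun _ => 0) fun z hz => normed_shrinkingBump_eq_zero
      (hy z (by rwa [uIcc_of_le (by linarith)] at hz)), intervalIntegral.integral_zero]
  have hdecr := hE (fun y => ∫ z in (y - d)..(y - c), η z) (contDiff_integral_sub_sub hsmooth c d)
    (fun y => intervalIntegral.integral_nonneg (by linarith) fun z _ =>
      (shrinkingBump ℝ n).nonneg_normed z)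
    (hvanish a fun z hz => le_abs.2 (Or.inr (by linarith [hz.2])))
    ⟨d + (shrinkingBump ℝ n).rOut, hdb, fun y hy => hvanish y fun z hz =>
      le_abs.2 (Or.inl (by linarith [hz.1]))⟩
  have hloc : LocallyIntegrable ((Ioc a b).indicator E) volume :=
    ((integrable_indicator_iff measurableSet_Ioc).2 hint).locallyIntegrable
  have hab : a ≤ b := by linarith [(shrinkingBump ℝ n).rOut_pos]
  rw [deriv_integral_sub_sub hsmooth.continuous, intervalIntegral.integral_of_le hab,
    ← integral_indicator measurableSet_Ioc] at hdecr
  rw [← sub_nonneg, mollify_eq_integral_mul, mollify_eq_integral_mul,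
    ← integral_sub (integrable_normed_sub_mul hloc n c) (integrable_normed_sub_mul hloc n d)]
  refine hdecr.trans_eq (integral_congr_ae (ae_of_all _ fun y => ?_))
  simp only [indicator_apply, hη]
  split_ifs <;> ring

lemma exists_ae_antitoneOn (hE : IsWeaklyDecreasing a b E) (hint : IntegrableOn E (Ioc a b)) :
    ∃ A ∈ ae (volume : Measure ℝ), AntitoneOn E (A ∩ Ioo a b) := by
  refine ⟨_, ae_mollify_tendsto ((integrable_indicator_iff
    measurableSet_Ioc).2 hint).locallyIntegrable, fun c hc d hd hcd => ?_⟩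
  have hlim : ∀ {x}, x ∈ Ioo a b → ((Ioc a b).indicator E) x = E x := fun hx =>
    indicator_of_mem (Ioo_subset_Ioc_self hx) E
  rw [← hlim hc.2, ← hlim hd.2]
  have hleft := (shrinkingBump_rOut_tendsto (E := ℝ)).eventually_le_const (sub_pos.2 hc.2.1)
  have hright := (shrinkingBump_rOut_tendsto (E := ℝ)).eventually_lt_const (sub_pos.2 hd.2.2)
  refine le_of_tendsto_of_tendsto hd.1 hc.1 ?_
  filter_upwards [hleft, hright] with n hn hn'
  exact hE.mollify_le_mollify hint (by linarith) hcd (by linarith)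

end IsWeaklyDecreasing

instance neBot_nhdsGT_inf_ae (s : ℝ) : NeBot (𝓝[>] s ⊓ ae volume) := by
  refine inf_neBot_iff.2 fun A hA B hB => ?_
  obtain ⟨v, hv, hsub⟩ := mem_nhdsGT_iff_exists_Ioo_subset.1 hA
  have hpos : volume (Ioo s v ∩ B) ≠ 0 := by
    rw [measure_inter_conull hB, Real.volume_Ioo]
    exact (ENNReal.ofReal_pos.2 (sub_pos.2 hv)).ne'
  exact (nonempty_of_measure_ne_zero hpos).mono (inter_subset_inter_left B hsub)

lemma IsWeaklyDecreasing.ae_le_of_tendsto {E : ℝ → ℝ} {a b s e : ℝ}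
    (hE : IsWeaklyDecreasing a b E) (hint : IntegrableOn E (Ioc a b)) (has : a ≤ s)
    (hlim : Tendsto E (𝓝[>] s ⊓ ae volume) (𝓝 e)) : ∀ᵐ t, t ∈ Ioo s b → E t ≤ e := by
  obtain ⟨A, hA, hanti⟩ := hE.exists_ae_antitoneOn hint
  filter_upwards [hA] with t htA ht
  refine ge_of_tendsto hlim ?_
  filter_upwards [mem_inf_of_left (Ioo_mem_nhdsGT ht.1), mem_inf_of_right hA] with c hc hcA
  exact hanti ⟨hcA, has.trans_lt hc.1, hc.2.trans ht.2⟩ ⟨htA, has.trans_lt ht.1, ht.2⟩ hc.2.le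

end WeaklyDecreasing

section Energy

variable {N : ℕ} {p : ℝ → ℝ} {a b s t T C e : ℝ} {ρ ρ' : ℝ → Space N → ℝ}
  {u u' : ℝ → Space N → Space N}

namespace IsBoundedState

lemma measurable_energy (h : IsBoundedState C ρ u) (hp : IsPressure p) :
    Measurable fun z : ℝ × Space N => energyDensity p (ρ z.1 z.2) (u z.1 z.2) :=
  ((measurable_const.mul h.measurable_density).mul (h.measurable_velocity.norm.pow_const 2)).add
    (hp.measurable_potential h.measurable_density fun z => h.nonneg z.1 z.2)

lemma exists_abs_energy_le (h : IsBoundedState C ρ u) (hp : IsPressure p) :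
    ∃ M, ∀ t, ∀ x ∈ cell N, |energyDensity p (ρ t x) (u t x)| ≤ M := by
  obtain ⟨M, hM⟩ := hp.exists_abs_potential_le C
  refine ⟨1 / 2 * C * C ^ 2 + M, fun t x hx => (abs_add_le _ _).trans
    (add_le_add ?_ (hM _ (h.nonneg t x) (h.le t x hx)))⟩
  have hρ := h.nonneg t x
  have hC := hρ.trans (h.le t x hx)
  rw [abs_of_nonneg (by positivity)]
  gcongr
  exacts [h.le t x hx, h.norm_le t x hx]

lemma integrable_energy_stMeasure (h : IsBoundedState C ρ u) (hp : IsPressure p) (a b : ℝ) :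
    Integrable (fun z : ℝ × Space N => energyDensity p (ρ z.1 z.2) (u z.1 z.2))
      (stMeasure N a b) := by
  obtain ⟨M, hM⟩ := h.exists_abs_energy_le hp
  exact integrable_stMeasure_of_bound (h.measurable_energy hp).aestronglyMeasurable
    fun t _ x hx => hM t x hx

lemma integrable_energy (h : IsBoundedState C ρ u) (hp : IsPressure p) (t : ℝ) :
    Integrable (fun x => energyDensity p (ρ t x) (u t x)) (cellMeasure N) := by
  obtain ⟨M, hM⟩ := h.exists_abs_energy_le hp
  exact integrable_cell_of_bound
    ((h.measurable_energy hp).comp measurable_prodMk_left).aestronglyMeasurable (hM t)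

end IsBoundedState

lemma totalEnergy_congr (h : ∀ᵐ x ∂(cellMeasure N), ρ' t x = ρ t x ∧ u' t x = u t x) :
    totalEnergy p ρ' u' t = totalEnergy p ρ u t := by
  refine integral_congr_ae ?_
  filter_upwards [h] with x hx
  rw [hx.1, hx.2]

lemma IsWeakSolution.integrableOn_totalEnergy (h : IsWeakSolution p T ρ u) (hp : IsPressure p) :
    IntegrableOn (totalEnergy p ρ u) (Ioc 0 T) := by
  obtain ⟨C, ρ', u', hsol, heq⟩ := h.exists_isBoundedSolution hp.continuousOn
  have hint : IntegrableOn (totalEnergy p ρ' u') (Ioc 0 T) :=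
    (hsol.integrable_energy_stMeasure hp 0 T).integral_prod_left
  exact hint.congr_fun (fun t ht => totalEnergy_congr (heq t (Ioc_subset_Icc_self ht)))
    measurableSet_Ioc

namespace IsAdmissible

lemma isWeaklyDecreasing_totalEnergy (h : IsAdmissible p T ρ u) :
    IsWeaklyDecreasing 0 T (totalEnergy p ρ u) := by
  rintro ψ hψ hpos h0 ⟨c, hc, hz⟩
  have hineq := h.energy_inequality (fun t _ => ψ t)
    ⟨hψ.comp contDiff_fst, fun _ _ _ => rfl⟩ (fun t _ _ => hpos t) ⟨c, hc, fun t ht _ => hz t ht⟩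
  simpa only [fderiv_fun_const, Pi.zero_apply, _root_.zero_apply, mul_zero, add_zero,
    h0, integral_zero, integral_mul_const, totalEnergy] using hineq

lemma ae_totalEnergy_le (h : IsAdmissible p T ρ u) (hp : IsPressure p) (hs : 0 ≤ s)
    (he : IsRightEnergy p ρ u s e) : ∀ᵐ t, t ∈ Ioo s T → totalEnergy p ρ u t ≤ e :=
  h.isWeaklyDecreasing_totalEnergy.ae_le_of_tendsto (h.weak.integrableOn_totalEnergy hp) hs he

end IsAdmissible

end Energy

/-! ### The competitor -/

section Competitor

variable {N : ℕ} {p : ℝ → ℝ} {T a b e t : ℝ} {ρ ρ' r : ℝ → Space N → ℝ}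
  {u u' U : ℝ → Space N → Space N}

lemma IsSmoothSolution.continuous_totalEnergy_clampTime (h : IsSmoothSolution p a b r U)
    (hp : IsPressure p) (hab : a ≤ b) :
    Continuous (totalEnergy p (clampTime a b r) (clampTime a b U)) := by
  have hr := h.isC1Periodic_density.continuous_clampTime hab
  have hU := h.isC1Periodic_velocity.continuous_clampTime hab
  have hpot : Continuous fun z : ℝ × Space N =>
      pressurePotential p (Function.uncurry (clampTime a b r) z) :=
    ContinuousOn.comp_continuous (s := Ioi 0)
      (fun z hz => (hp.hasDerivAt_potential hz).continuousAt.continuousWithinAt) hr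
      fun z => h.density_pos _ (max_min_mem_Icc hab z.1) z.2
  refine continuous_parametric_integral_of_continuous ?_ (isCompact_cell N)
  exact ((continuous_const.mul hr).mul (hU.norm.pow 2)).add hpot

lemma isRightEnergy_glueAt (hcont : ContinuousAt (totalEnergy p r U) t) (hat : a ≤ t) :
    IsRightEnergy p (glueAt a ρ r) (glueAt a u U) t (totalEnergy p r U t) := by
  refine Tendsto.congr' ?_ (hcont.mono_left (inf_le_left.trans nhdsWithin_le_nhds))
  filter_upwards [mem_inf_of_left self_mem_nhdsWithin] with s hs
  simp only [totalEnergy, glueAt_of_lt _ _ (hat.trans_lt hs)]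

/-- Maximal dissipation rules out that the energy of the solution jumps, at the branching time,
above the energy of a competitor. -/
lemma IsAdmissible.ae_totalEnergy_le_of_competitor (hadm : IsAdmissible p T ρ u)
    (hp : IsPressure p) (hmax : MaximalDissipation p T ρ u) (ha : 0 ≤ a) (hab : a < b)
    (hbT : b ≤ T) (hweak : IsWeakSolution p b ρ' u')
    (hagree : ∀ t ∈ Icc 0 a, ∀ᵐ x ∂(cellMeasure N), ρ t x = ρ' t x ∧ u t x = u' t x)
    {g : ℝ → ℝ} (hg : ∀ t ∈ Ioo a b, IsRightEnergy p ρ' u' t (g t))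
    (hlim : Tendsto g (𝓝[>] a) (𝓝 e)) : ∀ᵐ t, t ∈ Ioo a T → totalEnergy p ρ u t ≤ e := by
  obtain ⟨σ, hσ, hσa, hσE⟩ := hmax a b ρ' u' ha hab hbT hweak
    (fun t ht => (hagree t ht).mono fun x hx => ⟨hx.1, by rw [hx.1, hx.2]⟩)
    fun t ht => ⟨g t, hg t ht⟩
  have hle : ∀ n, ∀ᵐ t, t ∈ Ioo (σ n) T → totalEnergy p ρ u t ≤ g (σ n) := fun n => by
    obtain ⟨e₁, e₂, he₁, he₂, h12⟩ := hσE n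
    filter_upwards [hadm.ae_totalEnergy_le hp (ha.trans (hσ n).1.le) he₁] with t ht hmem
    exact (ht hmem).trans (h12.trans_eq (tendsto_nhds_unique he₂ (hg _ (hσ n))))
  have hgσ : Tendsto (g ∘ σ) atTop (𝓝 e) :=
    hlim.comp (tendsto_nhdsWithin_iff.2 ⟨hσa, .of_forall fun n => (hσ n).1⟩)
  filter_upwards [ae_all_iff.2 hle] with t ht hmem
  refine ge_of_tendsto hgσ ?_
  filter_upwards [hσa.eventually_lt_const hmem.1] with n hn using ht n ⟨hn, hmem.2⟩

lemma IsAdmissible.ae_totalEnergy_le_smooth (hadm : IsAdmissible p T ρ u) (hp : IsPressure p)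
    (hmax : MaximalDissipation p T ρ u) (hsm : IsSmoothSolution p a b r U) (ha : 0 ≤ a)
    (hab : a < b) (hbT : b ≤ T)
    (hagree : ∀ᵐ x ∂(cellMeasure N), ρ a x = r a x ∧ u a x = U a x) :
    ∀ᵐ t, t ∈ Ioo a T → totalEnergy p ρ u t ≤ totalEnergy p r U a := by
  obtain ⟨C₁, ρ', u', hsol, heq⟩ := hadm.weak.exists_isBoundedSolution hp.continuousOn
  obtain ⟨C₂, hclamp⟩ := hsm.exists_isBoundedSolution_clampTime hp hab.le
  have hleft := left_mem_Icc.2 hab.le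
  have hcompetitor := (hsol.mono le_rfl (hab.le.trans hbT)).glue hclamp ha (by
    filter_upwards [heq a ⟨ha, hab.le.trans hbT⟩, hagree] with x hx hx'
    rw [clampTime_of_mem _ hleft, clampTime_of_mem _ hleft]
    exact ⟨hx.1.trans hx'.1, hx.2.trans hx'.2⟩)
  have hsame : ∀ t ∈ Icc 0 a, ∀ᵐ x ∂(cellMeasure N), ρ t x = glueAt a ρ' (clampTime a b r) t x ∧
      u t x = glueAt a u' (clampTime a b U) t x := fun t ht => by
    filter_upwards [heq t ⟨ht.1, ht.2.trans (hab.le.trans hbT)⟩] with x hx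
    rw [glueAt_of_le _ _ ht.2, glueAt_of_le _ _ ht.2]
    exact ⟨hx.1.symm, hx.2.symm⟩
  have hcont := hsm.continuous_totalEnergy_clampTime hp hab.le
  have hlim : Tendsto (totalEnergy p (clampTime a b r) (clampTime a b U)) (𝓝[>] a)
      (𝓝 (totalEnergy p r U a)) := by
    simpa only [totalEnergy, clampTime_of_mem _ hleft] using
      (hcont.tendsto a).mono_left nhdsWithin_le_nhds
  refine hadm.ae_totalEnergy_le_of_competitor hp hmax ha hab hbT (hcompetitor.isWeakSolution ?_)
    hsame (fun t ht => isRightEnergy_glueAt hcont.continuousAt ht.1.le) hlim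
  filter_upwards [hsame 0 (left_mem_Icc.2 ha), hadm.weak.initial_pos] with x hx hpos
  rwa [← hx.1]

end Competitor

/-! ### Weak-strong uniqueness -/

section Gronwall

variable {f : ℝ → ℝ} {a b L : ℝ}

/-- The primitive `F` of `f` need not be differentiable, so that Grönwall's inequality is applied
to the primitive of `F`. -/
lemma integral_eq_zero_of_ae_le_mul_integral (hab : a ≤ b) (hf : Integrable f) (hf₀ : 0 ≤ f)
    (hle : ∀ᵐ t, t ∈ Ioo a b → f t ≤ L * ∫ s in a..t, f s) : ∫ s in a..b, f s = 0 := by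
  set F : ℝ → ℝ := fun t => ∫ s in a..t, f s
  have hFc : Continuous F :=
    intervalIntegral.continuous_primitive (fun _ _ => hf.intervalIntegrable) a
  have hF₀ : ∀ t, a ≤ t → 0 ≤ F t := fun t ht =>
    intervalIntegral.integral_nonneg ht fun s _ => hf₀ s
  set G : ℝ → ℝ := fun t => ∫ s in a..t, F s
  have hGderiv : ∀ t, HasDerivAt G (F t) t := fun t =>
    (hFc.integral_hasStrictDerivAt a t).hasDerivAt
  have hG₀ : ∀ t, a ≤ t → 0 ≤ G t := fun t ht =>
    intervalIntegral.integral_nonneg ht fun s hs => hF₀ s hs.1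
  have hFG : ∀ t ∈ Icc a b, F t ≤ L * G t := fun t ht => by
    rw [← intervalIntegral.integral_const_mul]
    refine intervalIntegral.integral_mono_ae_restrict ht.1 hf.intervalIntegrable
      ((continuous_const.mul hFc).intervalIntegrable _ _) ?_
    rw [← restrict_Ioo_eq_restrict_Icc, Filter.EventuallyLE, ae_restrict_iff' measurableSet_Ioo]
    filter_upwards [hle] with s hs hmem using hs ⟨hmem.1, hmem.2.trans_le ht.2⟩
  have hGb : ‖G b‖ ≤ gronwallBound 0 L 0 (b - a) :=
    norm_le_gronwallBound_of_norm_deriv_right_le (f' := F)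
      (fun t _ => (hGderiv t).continuousAt.continuousWithinAt)
      (fun t _ => (hGderiv t).hasDerivWithinAt) (by simp [G]) (fun t ht => by
        rw [Real.norm_of_nonneg (hF₀ t ht.1), Real.norm_of_nonneg (hG₀ t ht.1), add_zero]
        exact hFG t (Ico_subset_Icc_self ht)) b (right_mem_Icc.2 hab)
  rw [gronwallBound_ε0_δ0, norm_le_zero_iff] at hGb
  have hFb := hFG b (right_mem_Icc.2 hab)
  rw [hGb, mul_zero] at hFb
  exact le_antisymm hFb (hF₀ b hab)

lemma ae_eq_zero_of_ae_le_mul_integral (hab : a ≤ b) (hf : IntegrableOn f (Ioo a b))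
    (hf₀ : ∀ t ∈ Ioo a b, 0 ≤ f t)
    (hle : ∀ᵐ t, t ∈ Ioo a b → f t ≤ L * ∫ s in a..t, f s) : ∀ᵐ t, t ∈ Ioo a b → f t = 0 := by
  have hint := hf.integrable_indicator measurableSet_Ioo
  have hnonneg : 0 ≤ (Ioo a b).indicator f := fun t => indicator_nonneg hf₀ t
  have hzero := integral_eq_zero_of_ae_le_mul_integral hab hint hnonneg (L := L) <| by
    filter_upwards [hle] with t ht hmem
    rw [indicator_of_mem hmem]
    refine (ht hmem).trans_eq (congrArg (L * ·) ?_)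
    rw [intervalIntegral.integral_of_le hmem.1.le, intervalIntegral.integral_of_le hmem.1.le]
    refine setIntegral_congr_fun measurableSet_Ioc fun s hs => ?_
    exact (indicator_of_mem (mem_Ioo.2 ⟨hs.1, hs.2.trans_lt hmem.2⟩) f).symm
  rw [intervalIntegral.integral_of_le hab, integral_Ioc_eq_integral_Ioo,
    setIntegral_indicator measurableSet_Ioo, inter_self,
    setIntegral_eq_zero_iff_of_nonneg_ae (ae_restrict_of_forall_mem measurableSet_Ioo hf₀) hf,
    Filter.EventuallyEq, ae_restrict_iff' measurableSet_Ioo] at hzero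
  exact hzero

end Gronwall

section RelativeEnergy

variable {N : ℕ} {p : ℝ → ℝ} {a b t τ C : ℝ} {x : Space N} {ρ r : ℝ → Space N → ℝ}
  {u U : ℝ → Space N → Space N}

/-- The relative energy density `½ ρ|u - U|² + P(ρ) - P(r) - P'(r)(ρ - r)` of `[ρ, u]` with respect
to `[r, U]`. -/
noncomputable def relEnergy (p : ℝ → ℝ) (ρ : ℝ → Space N → ℝ) (u : ℝ → Space N → Space N)
    (r : ℝ → Space N → ℝ) (U : ℝ → Space N → Space N) (t : ℝ) (x : Space N) : ℝ :=
  1 / 2 * ρ t x * ‖u t x - U t x‖ ^ 2 + relPotential p (ρ t x) (r t x)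

/-- The function `½|U|² - P'(r)`, with which the continuity equation is tested in the relative
energy method. -/
noncomputable def massMultiplier (p : ℝ → ℝ) (r : ℝ → Space N → ℝ) (U : ℝ → Space N → Space N)
    (t : ℝ) (x : Space N) : ℝ :=
  (1 / 2 : ℝ) • ⟪U t x, U t x⟫ - potentialDeriv p (r t x)

/-- The source `-ρ (u - U) · ((u - U) · ∇)U - div U (p(ρ) - p(r) - p'(r)(ρ - r))` in the relative
energy inequality. -/
noncomputable def relRemainder (p : ℝ → ℝ) (ρ : ℝ → Space N → ℝ) (u : ℝ → Space N → Space N)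
    (r : ℝ → Space N → ℝ) (U : ℝ → Space N → Space N) (t : ℝ) (x : Space N) : ℝ :=
  -(ρ t x * ⟪u t x - U t x, stDeriv U t x (0, u t x - U t x)⟫)
    - spaceDiv (stDeriv U t x) * relPressure p (ρ t x) (r t x)

lemma relEnergy_eq (hr : 0 < r t x) :
    relEnergy p ρ u r U t x = energyDensity p (ρ t x) (u t x) - ⟪momentumDensity ρ u t x, U t x⟫
      + ⟪ρ t x, massMultiplier p r U t x⟫ + p (r t x) := by
  rw [relEnergy, relPotential, energyDensity, massMultiplier, momentumDensity, inner_eq_mul,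
    pressurePotential_eq hr, real_inner_smul_left, norm_sub_sq_real, real_inner_self_eq_norm_sq,
    smul_eq_mul]
  ring

lemma relEnergy_nonneg (hp : IsPressure p) (hρ : 0 ≤ ρ t x) (hr : 0 < r t x) :
    0 ≤ relEnergy p ρ u r U t x :=
  add_nonneg (by positivity) (hp.relPotential_nonneg hr hρ)

lemma relEnergy_eq_zero_of_eq (hρ : ρ t x = r t x) (hu : u t x = U t x) :
    relEnergy p ρ u r U t x = 0 := by
  rw [relEnergy, hρ, hu, relPotential_self, sub_self, norm_zero]
  ring

lemma eq_of_relEnergy_eq_zero (hp : IsPressure p) (hρ : 0 ≤ ρ t x) (hr : 0 < r t x)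
    (h : relEnergy p ρ u r U t x = 0) : ρ t x = r t x ∧ u t x = U t x := by
  obtain ⟨hkin, hpot⟩ := (add_eq_zero_iff_of_nonneg (by positivity)
    (hp.relPotential_nonneg hr hρ)).1 h
  have hρr := hp.eq_of_relPotential_eq_zero hr hρ hpot
  rw [hρr] at hkin
  have hnorm := (mul_eq_zero.1 hkin).resolve_left (by positivity)
  exact ⟨hρr, sub_eq_zero.1 (norm_eq_zero.1 (pow_eq_zero_iff two_ne_zero |>.1 hnorm))⟩

lemma norm_apply_zero_prodMk_le (L : ℝ × Space N →L[ℝ] Space N) (v : Space N) :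
    ‖L (0, v)‖ ≤ ‖L‖ * ‖v‖ := by
  simpa [Prod.norm_def] using L.le_opNorm (0, v)

lemma abs_inner_apply_le (L : ℝ × Space N →L[ℝ] Space N) (v : Space N) :
    |⟪v, L (0, v)⟫| ≤ ‖L‖ * ‖v‖ ^ 2 :=
  calc |⟪v, L (0, v)⟫| ≤ ‖v‖ * ‖L (0, v)‖ := abs_real_inner_le_norm _ _
    _ ≤ ‖v‖ * (‖L‖ * ‖v‖) := by gcongr; exact norm_apply_zero_prodMk_le L v
    _ = ‖L‖ * ‖v‖ ^ 2 := by ring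

lemma abs_spaceDiv_le (L : ℝ × Space N →L[ℝ] Space N) : |spaceDiv L| ≤ N * ‖L‖ := by
  refine (Finset.abs_sum_le_sum_abs _ _).trans ?_
  have hcoord : ∀ j ∈ Finset.univ, |L (0, unitVec j) j| ≤ ‖L‖ := fun j _ =>
    calc |L (0, unitVec j) j| ≤ ‖L (0, unitVec j)‖ := PiLp.norm_apply_le (L (0, unitVec j)) j
      _ ≤ ‖L‖ := by simpa [norm_unitVec] using norm_apply_zero_prodMk_le L (unitVec j)
  simpa using Finset.sum_le_card_nsmul _ _ _ hcoord

namespace IsSmoothSolution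

lemma isC1Periodic_massMultiplier (hp : IsPressure p) (h : IsSmoothSolution p a b r U) :
    IsC1Periodic a b (massMultiplier p r U) :=
  ((h.isC1Periodic_velocity.inner h.isC1Periodic_velocity).comp (s := univ)
    (contDiff_const_smul (1 / 2 : ℝ)).contDiffOn fun _ _ _ => trivial).sub
    (h.isC1Periodic_density.comp hp.contDiffOn_potentialDeriv h.density_pos)

lemma stDeriv_massMultiplier_apply (hp : IsPressure p) (h : IsSmoothSolution p a b r U)
    (ht : t ∈ Ioo a b) (x : Space N) (v : ℝ × Space N) :
    stDeriv (massMultiplier p r U) t x v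
      = ⟪U t x, stDeriv U t x v⟫ - deriv p (r t x) / r t x * stDeriv r t x v := by
  have hU := h.isC1Periodic_velocity.differentiableAt ht x
  have hUU := (h.isC1Periodic_velocity.inner h.isC1Periodic_velocity).differentiableAt ht x
  have hr := h.isC1Periodic_density
  have hP := (hr.comp hp.contDiffOn_potentialDeriv h.density_pos).differentiableAt ht x
  have hpos := h.density_pos t (Ioo_subset_Icc_self ht) x
  have hsub : stDeriv (massMultiplier p r U) t x v
      = (1 / 2 : ℝ) * stDeriv (fun t x => ⟪U t x, U t x⟫) t x v
        - stDeriv (fun t x => potentialDeriv p (r t x)) t x v :=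
    DFunLike.congr_fun ((hUU.hasFDerivAt.const_smul (1 / 2 : ℝ)).sub hP.hasFDerivAt).fderiv v
  rw [hsub, stDeriv_inner hU hU, stDeriv_comp_apply (hp.hasDerivAt_potentialDeriv hpos)
    (hr.differentiableAt ht x), real_inner_comm (U t x), smul_eq_mul]
  ring

lemma pressure_transport (hp : IsPressure p) (h : IsSmoothSolution p a b r U) (ht : t ∈ Ioo a b)
    (x : Space N) :
    stDeriv (fun t x => p (r t x)) t x (1, 0)
        + ∑ j, stDeriv (fun t x => p (r t x) • U t x j) t x (0, unitVec j)
      = (p (r t x) - deriv p (r t x) * r t x) * spaceDiv (stDeriv U t x) := by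
  have hP := (h.isC1Periodic_pressure hp).differentiableAt ht x
  have hU := h.isC1Periodic_velocity
  have hflux : ∀ j, stDeriv (fun t x => p (r t x) • U t x j) t x (0, unitVec j)
      = p (r t x) * stDeriv U t x (0, unitVec j) j
        + U t x j • stDeriv (fun t x => p (r t x)) t x (0, unitVec j) := fun j => by
    rw [stDeriv_smul_apply hP ((hU.component j).differentiableAt ht x),
      stDeriv_component_apply (hU.differentiableAt ht x), smul_eq_mul, smul_eq_mul, smul_eq_mul,
      mul_comm (U t x j)]
  have htransport : stDeriv (fun t x => p (r t x)) t x (1, U t x)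
      = -(r t x * spaceDiv (stDeriv U t x)) * deriv p (r t x) := by
    rw [stDeriv_comp_apply (hp.hasDerivAt (h.density_pos t (Ioo_subset_Icc_self ht) x))
      (h.isC1Periodic_density.differentiableAt ht x), h.stDeriv_density_transport ht, smul_eq_mul]
  rw [stDeriv_one_apply] at htransport
  simp only [hflux, Finset.sum_add_distrib, ← Finset.mul_sum, sum_smul_stDeriv_unitVec]
  rw [← spaceDiv]
  linear_combination htransport

lemma relRemainder_eq (hp : IsPressure p) (h : IsSmoothSolution p a b r U) (ht : t ∈ Ioo a b)
    (x : Space N) :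
    relRemainder p ρ u r U t x
      = weakIntegrand ρ (massFlux ρ u) (massMultiplier p r U) t x
        - weakIntegrand (momentumDensity ρ u) (momentumFlux p ρ u) U t x
        + (stDeriv (fun t x => p (r t x)) t x (1, 0)
          + ∑ j, stDeriv (fun t x => p (r t x) • U t x j) t x (0, unitVec j)) := by
  have hpos := h.density_pos t (Ioo_subset_Icc_self ht) x
  have hsplit : ((1 : ℝ), u t x) = (1, U t x) + (0, u t x - U t x) := by simp
  have hmass : deriv p (r t x) / r t x * stDeriv r t x (1, U t x)
      = -(deriv p (r t x) * spaceDiv (stDeriv U t x)) := by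
    rw [h.stDeriv_density_transport ht]
    field_simp
  have hmom : ⟪u t x - U t x, stDeriv U t x (1, U t x)⟫
      = -(deriv p (r t x) / r t x * stDeriv r t x (0, u t x - U t x)) := by
    have htransport := h.stDeriv_velocity_transport hp ht x (u t x - U t x)
    rw [real_inner_comm]
    field_simp
    linarith
  rw [weakIntegrand_massFlux, weakIntegrand_momentumFlux, h.pressure_transport hp ht,
    h.stDeriv_massMultiplier_apply hp ht, hsplit, map_add, map_add, relRemainder, relPressure]
  rw [inner_sub_left] at hmom
  simp only [inner_add_right, inner_sub_left]
  linear_combination ρ t x * hmom + ρ t x * hmass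

lemma exists_abs_relPressure_le_mul_relPotential (hp : IsPressure p)
    (h : IsSmoothSolution p a b r U) (C : ℝ) :
    ∃ c, ∀ t ∈ Icc a b, ∀ x ∈ cell N, ∀ s ∈ Icc 0 C,
      |relPressure p s (r t x)| ≤ c * relPotential p s (r t x) := by
  have hcomp : IsCompact (Function.uncurry r '' (Icc a b ×ˢ cell N)) :=
    (isCompact_Icc.prod (isCompact_cell N)).image_of_continuousOn
      (h.contDiffOn_density.continuousOn.mono (prod_mono_right (subset_univ _)))
  obtain ⟨c, hc⟩ := hp.exists_abs_relPressure_le hcomp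
    (forall_mem_image.2 fun z hz => h.density_pos z.1 hz.1 z.2)
    (forall_mem_image.2 fun z hz => h.flux_regular z.1 hz.1 z.2) C
  exact ⟨c, fun t ht x hx => hc _ ⟨(t, x), ⟨ht, hx⟩, rfl⟩⟩

lemma exists_relRemainder_le (hp : IsPressure p) (h : IsSmoothSolution p a b r U)
    (hst : IsBoundedState C ρ u) :
    ∃ L, ∀ t ∈ Ioo a b, ∀ x ∈ cell N, relRemainder p ρ u r U t x ≤ L * relEnergy p ρ u r U t x := by
  obtain ⟨c, hc⟩ := h.exists_abs_relPressure_le_mul_relPotential hp C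
  obtain ⟨K, hK⟩ := h.isC1Periodic_velocity.exists_norm_stDeriv_le
  refine ⟨max (2 * K) (N * K * c), fun t ht x hx => ?_⟩
  have htI := Ioo_subset_Icc_self ht
  have hρ := hst.nonneg t x
  have hpot := hp.relPotential_nonneg (h.density_pos t htI x) hρ
  have hDU := hK t ht x hx
  have hK₀ : 0 ≤ K := (norm_nonneg _).trans hDU
  set w := u t x - U t x with hw
  have hkin : -(ρ t x * ⟪w, stDeriv U t x (0, w)⟫) ≤ 2 * K * (1 / 2 * ρ t x * ‖w‖ ^ 2) :=
    calc -(ρ t x * ⟪w, stDeriv U t x (0, w)⟫) = ρ t x * -⟪w, stDeriv U t x (0, w)⟫ := by ring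
      _ ≤ ρ t x * (‖stDeriv U t x‖ * ‖w‖ ^ 2) := by
        gcongr
        exact (neg_le_abs _).trans (abs_inner_apply_le _ w)
      _ ≤ ρ t x * (K * ‖w‖ ^ 2) := by gcongr
      _ = 2 * K * (1 / 2 * ρ t x * ‖w‖ ^ 2) := by ring
  have hpress : -(spaceDiv (stDeriv U t x) * relPressure p (ρ t x) (r t x))
      ≤ N * K * c * relPotential p (ρ t x) (r t x) :=
    calc -(spaceDiv (stDeriv U t x) * relPressure p (ρ t x) (r t x))
        ≤ |spaceDiv (stDeriv U t x)| * |relPressure p (ρ t x) (r t x)| :=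
          (neg_le_abs _).trans (abs_mul _ _).le
      _ ≤ N * K * (c * relPotential p (ρ t x) (r t x)) := by
        gcongr
        · exact (abs_spaceDiv_le _).trans (by gcongr)
        · exact hc t htI x hx _ ⟨hρ, hst.le t x hx⟩
      _ = N * K * c * relPotential p (ρ t x) (r t x) := by ring
  rw [relRemainder, relEnergy, ← hw, mul_add, sub_eq_add_neg]
  exact add_le_add (hkin.trans (by gcongr; exact le_max_left _ _))
    (hpress.trans (by gcongr; exact le_max_right _ _))

lemma integrable_relEnergy_stMeasure (hp : IsPressure p) (h : IsSmoothSolution p a b r U)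
    (hsol : IsBoundedSolution p a b C ρ u) (hτ : τ ≤ b) :
    Integrable (fun z => relEnergy p ρ u r U z.1 z.2) (stMeasure N a τ) := by
  refine ((((hsol.integrable_energy_stMeasure hp a τ).sub
    (hsol.momentum.integrable_stMeasure_inner h.isC1Periodic_velocity hτ)).add
    (hsol.mass.integrable_stMeasure_inner (h.isC1Periodic_massMultiplier hp) hτ)).add
    ((h.isC1Periodic_pressure hp).integrable_stMeasure hτ)).congr ?_
  filter_upwards [ae_stMeasure_mem a τ] with z hz
  exact (relEnergy_eq (h.density_pos z.1 ⟨hz.1.1.le, hz.1.2.le.trans hτ⟩ z.2)).symm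

lemma integrable_relEnergy (hp : IsPressure p) (h : IsSmoothSolution p a b r U)
    (hsol : IsBoundedSolution p a b C ρ u) (ht : t ∈ Icc a b) :
    Integrable (relEnergy p ρ u r U t) (cellMeasure N) :=
  ((((hsol.integrable_energy hp t).sub
    (hsol.momentum.integrable_slice_inner h.isC1Periodic_velocity ht)).add
    (hsol.mass.integrable_slice_inner (h.isC1Periodic_massMultiplier hp) ht)).add
    ((h.isC1Periodic_pressure hp).integrable_slice ht)).congr
    (ae_of_all _ fun x => (relEnergy_eq (h.density_pos t ht x)).symm)

lemma integral_relEnergy (hp : IsPressure p) (h : IsSmoothSolution p a b r U)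
    (hsol : IsBoundedSolution p a b C ρ u) (ht : t ∈ Icc a b) :
    ∫ x, relEnergy p ρ u r U t x ∂(cellMeasure N)
      = totalEnergy p ρ u t - ∫ x, ⟪momentumDensity ρ u t x, U t x⟫ ∂(cellMeasure N)
        + ∫ x, ⟪ρ t x, massMultiplier p r U t x⟫ ∂(cellMeasure N)
        + ∫ x, p (r t x) ∂(cellMeasure N) := by
  have henergy := hsol.integrable_energy hp t
  have hmom := hsol.momentum.integrable_slice_inner h.isC1Periodic_velocity ht
  have hmass := hsol.mass.integrable_slice_inner (h.isC1Periodic_massMultiplier hp) ht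
  simp only [fun x => relEnergy_eq (p := p) (ρ := ρ) (u := u) (U := U) (h.density_pos t ht x)]
  rw [integral_add ((henergy.sub' hmom).fun_add hmass)
    ((h.isC1Periodic_pressure hp).integrable_slice ht),
    integral_add (henergy.sub' hmom) hmass, integral_sub henergy hmom, totalEnergy]

lemma integrable_pressure_transport (hp : IsPressure p) (h : IsSmoothSolution p a b r U)
    (hτ : τ ≤ b) :
    Integrable (fun z => stDeriv (fun t x => p (r t x)) z.1 z.2 (1, 0)
      + ∑ j, stDeriv (fun t x => p (r t x) • U t x j) z.1 z.2 (0, unitVec j)) (stMeasure N a τ) :=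
  have hpress := h.isC1Periodic_pressure hp
  (hpress.integrable_stDeriv_apply hτ (1, 0)).fun_add (integrable_finsetSum _ fun j _ =>
    (hpress.smul (h.isC1Periodic_velocity.component j)).integrable_stDeriv_apply hτ (0, unitVec j))

lemma integrable_relRemainder (hp : IsPressure p) (h : IsSmoothSolution p a b r U)
    (hsol : IsBoundedSolution p a b C ρ u) (hτ : τ ≤ b) :
    Integrable (fun z => relRemainder p ρ u r U z.1 z.2) (stMeasure N a τ) := by
  refine (((hsol.mass.integrable_weakIntegrand (h.isC1Periodic_massMultiplier hp) le_rfl hτ).sub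
    (hsol.momentum.integrable_weakIntegrand h.isC1Periodic_velocity le_rfl hτ)).add
    (h.integrable_pressure_transport hp hτ)).congr ?_
  filter_upwards [ae_stMeasure_mem a τ] with z hz
  exact (h.relRemainder_eq hp ⟨hz.1.1, hz.1.2.trans_le hτ⟩ z.2).symm

lemma integral_relRemainder (hp : IsPressure p) (h : IsSmoothSolution p a b r U)
    (hsol : IsBoundedSolution p a b C ρ u) (hτ : τ ≤ b) :
    ∫ z, relRemainder p ρ u r U z.1 z.2 ∂(stMeasure N a τ)
      = ∫ z, weakIntegrand ρ (massFlux ρ u) (massMultiplier p r U) z.1 z.2 ∂(stMeasure N a τ)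
        - ∫ z, weakIntegrand (momentumDensity ρ u) (momentumFlux p ρ u) U z.1 z.2
            ∂(stMeasure N a τ)
        + ∫ z, (stDeriv (fun t x => p (r t x)) z.1 z.2 (1, 0)
            + ∑ j, stDeriv (fun t x => p (r t x) • U t x j) z.1 z.2 (0, unitVec j))
            ∂(stMeasure N a τ) := by
  have hmass := hsol.mass.integrable_weakIntegrand (h.isC1Periodic_massMultiplier hp) le_rfl hτ
  have hmom := hsol.momentum.integrable_weakIntegrand h.isC1Periodic_velocity le_rfl hτ
  rw [← integral_sub hmass hmom, ← integral_add (hmass.sub' hmom)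
    (h.integrable_pressure_transport hp hτ)]
  refine integral_congr_ae ?_
  filter_upwards [ae_stMeasure_mem a τ] with z hz
  exact h.relRemainder_eq hp ⟨hz.1.1, hz.1.2.trans_le hτ⟩ z.2

lemma integral_relEnergy_sub_integral_relEnergy (hp : IsPressure p)
    (h : IsSmoothSolution p a b r U) (hsol : IsBoundedSolution p a b C ρ u) (ht : t ∈ Icc a b) :
    ∫ x, relEnergy p ρ u r U t x ∂(cellMeasure N) - ∫ x, relEnergy p ρ u r U a x ∂(cellMeasure N)
      = totalEnergy p ρ u t - totalEnergy p ρ u a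
        + ∫ z, relRemainder p ρ u r U z.1 z.2 ∂(stMeasure N a t) := by
  have hpress := h.isC1Periodic_pressure hp
  rw [h.integral_relEnergy hp hsol ht,
    h.integral_relEnergy hp hsol (left_mem_Icc.2 (ht.1.trans ht.2)),
    h.integral_relRemainder hp hsol ht.2,
    ← hsol.mass.balance_of_isC1Periodic (h.isC1Periodic_massMultiplier hp) ht,
    ← hsol.momentum.balance_of_isC1Periodic h.isC1Periodic_velocity ht,
    ← hpress.integral_slice_sub_eq_integral_stDeriv_add_sum
      (fun j => hpress.smul (h.isC1Periodic_velocity.component j)) ht]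
  ring

lemma integral_relEnergy_le (hp : IsPressure p) (h : IsSmoothSolution p a b r U)
    (hsol : IsBoundedSolution p a b C ρ u)
    (hagree : ∀ᵐ x ∂(cellMeasure N), ρ a x = r a x ∧ u a x = U a x) (ht : t ∈ Icc a b)
    (hE : totalEnergy p ρ u t ≤ totalEnergy p r U a) :
    ∫ x, relEnergy p ρ u r U t x ∂(cellMeasure N)
      ≤ ∫ z, relRemainder p ρ u r U z.1 z.2 ∂(stMeasure N a t) := by
  have hzero : ∫ x, relEnergy p ρ u r U a x ∂(cellMeasure N) = 0 :=
    integral_eq_zero_of_ae (hagree.mono fun x hx => relEnergy_eq_zero_of_eq hx.1 hx.2)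
  have hbalance := h.integral_relEnergy_sub_integral_relEnergy hp hsol ht
  rw [hzero, totalEnergy_congr hagree] at hbalance
  linarith

lemma ae_integral_relEnergy_eq_zero (hp : IsPressure p) (h : IsSmoothSolution p a b r U)
    (hsol : IsBoundedSolution p a b C ρ u) (hab : a ≤ b)
    (hagree : ∀ᵐ x ∂(cellMeasure N), ρ a x = r a x ∧ u a x = U a x)
    (hE : ∀ᵐ t, t ∈ Ioo a b → totalEnergy p ρ u t ≤ totalEnergy p r U a) :
    ∀ᵐ t, t ∈ Ioo a b → ∫ x, relEnergy p ρ u r U t x ∂(cellMeasure N) = 0 := by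
  obtain ⟨L, hL⟩ := h.exists_relRemainder_le hp hsol.toIsBoundedState
  have hint : IntegrableOn (fun t => ∫ x, relEnergy p ρ u r U t x ∂(cellMeasure N)) (Ioc a b) :=
    (h.integrable_relEnergy_stMeasure hp hsol le_rfl).integral_prod_left
  refine ae_eq_zero_of_ae_le_mul_integral hab (hint.mono_set Ioo_subset_Ioc_self)
    (fun t ht => integral_nonneg fun x => relEnergy_nonneg hp (hsol.nonneg t x)
      (h.density_pos t (Ioo_subset_Icc_self ht) x)) (L := L) ?_
  filter_upwards [hE] with t hEt ht
  have hint_t := h.integrable_relEnergy_stMeasure hp hsol ht.2.le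
  calc ∫ x, relEnergy p ρ u r U t x ∂(cellMeasure N)
      ≤ ∫ z, relRemainder p ρ u r U z.1 z.2 ∂(stMeasure N a t) :=
        h.integral_relEnergy_le hp hsol hagree (Ioo_subset_Icc_self ht) (hEt ht)
    _ ≤ ∫ z, L * relEnergy p ρ u r U z.1 z.2 ∂(stMeasure N a t) := by
        refine integral_mono_ae (h.integrable_relRemainder hp hsol ht.2.le) (hint_t.const_mul L) ?_
        filter_upwards [ae_stMeasure_mem a t] with z hz
        exact hL z.1 ⟨hz.1.1, hz.1.2.trans ht.2⟩ z.2 hz.2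
    _ = L * ∫ s in a..t, ∫ x, relEnergy p ρ u r U s x ∂(cellMeasure N) := by
        rw [integral_const_mul, intervalIntegral_eq_stMeasure ht.1.le hint_t]

lemma ae_eq_of_totalEnergy_le (hp : IsPressure p) (h : IsSmoothSolution p a b r U)
    (hsol : IsBoundedSolution p a b C ρ u) (hab : a ≤ b)
    (hagree : ∀ᵐ x ∂(cellMeasure N), ρ a x = r a x ∧ u a x = U a x)
    (hE : ∀ᵐ t, t ∈ Ioo a b → totalEnergy p ρ u t ≤ totalEnergy p r U a) :
    ∀ᵐ t, t ∈ Ioo a b → ∀ᵐ x ∂(cellMeasure N), ρ t x = r t x ∧ u t x = U t x := by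
  filter_upwards [h.ae_integral_relEnergy_eq_zero hp hsol hab hagree hE] with t hzero ht
  have htI := Ioo_subset_Icc_self ht
  filter_upwards [(integral_eq_zero_iff_of_nonneg (fun x => relEnergy_nonneg hp (hsol.nonneg t x)
    (h.density_pos t htI x)) (h.integrable_relEnergy hp hsol htI)).1 (hzero ht)] with x hx
  exact eq_of_relEnergy_eq_zero hp (hsol.nonneg t x) (h.density_pos t htI x) hx

end IsSmoothSolution

end RelativeEnergy

section AllTimes

variable {N : ℕ} {p : ℝ → ℝ} {a b t C : ℝ} {ρ r : ℝ → Space N → ℝ} {u U : ℝ → Space N → Space N}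

lemma IsBoundedSolution.ae_eq_of_ae_ae_eq {C₁ C₂ : ℝ} {ρ₁ ρ₂ : ℝ → Space N → ℝ}
    {u₁ u₂ : ℝ → Space N → Space N} (h₁ : IsBoundedSolution p a b C₁ ρ₁ u₁)
    (h₂ : IsBoundedSolution p a b C₂ ρ₂ u₂)
    (ha : ∀ᵐ x ∂(cellMeasure N), ρ₁ a x = ρ₂ a x ∧ u₁ a x = u₂ a x)
    (hab : ∀ᵐ t, t ∈ Ioo a b → ∀ᵐ x ∂(cellMeasure N), ρ₁ t x = ρ₂ t x ∧ u₁ t x = u₂ t x)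
    (ht : t ∈ Icc a b) :
    ∀ᵐ x ∂(cellMeasure N),
      ρ₁ t x = ρ₂ t x ∧ momentumDensity ρ₁ u₁ t x = momentumDensity ρ₂ u₂ t x := by
  have hst : ∀ᵐ z ∂(stMeasure N a b), ρ₁ z.1 z.2 = ρ₂ z.1 z.2 ∧ u₁ z.1 z.2 = u₂ z.1 z.2 :=
    ae_stMeasure_of_ae_ae ((measurableSet_eq_fun h₁.measurable_density h₂.measurable_density).inter
      (measurableSet_eq_fun h₁.measurable_velocity h₂.measurable_velocity)) hab
  have hmass := h₁.mass.ae_eq h₂.mass (ha.mono fun x hx => hx.1) (hst.mono fun z hz =>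
    ⟨hz.1, fun j => by rw [massFlux, massFlux, hz.1, hz.2]⟩) ht
  have hmom := h₁.momentum.ae_eq h₂.momentum
    (ha.mono fun x hx => by rw [momentumDensity, momentumDensity, hx.1, hx.2])
    (hst.mono fun z hz => ⟨by rw [momentumDensity, momentumDensity, hz.1, hz.2],
      fun j => by rw [momentumFlux, momentumFlux, hz.1, hz.2]⟩) ht
  exact hmass.and hmom

lemma IsSmoothSolution.ae_eq_of_ae_ae_eq (h : IsSmoothSolution p a b r U) (hp : IsPressure p)
    (hsol : IsBoundedSolution p a b C ρ u) (hab : a ≤ b)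
    (ha : ∀ᵐ x ∂(cellMeasure N), ρ a x = r a x ∧ u a x = U a x)
    (hae : ∀ᵐ t, t ∈ Ioo a b → ∀ᵐ x ∂(cellMeasure N), ρ t x = r t x ∧ u t x = U t x)
    (ht : t ∈ Icc a b) : ∀ᵐ x ∂(cellMeasure N), ρ t x = r t x ∧ u t x = U t x := by
  obtain ⟨C', hclamp⟩ := h.exists_isBoundedSolution_clampTime hp hab
  have heq := hsol.ae_eq_of_ae_ae_eq hclamp
    (by simpa only [clampTime_of_mem _ (left_mem_Icc.2 hab)] using ha)
    (hae.mono fun s hs hmem => by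
      simpa only [clampTime_of_mem _ (Ioo_subset_Icc_self hmem)] using hs hmem) ht
  simp only [momentumDensity, clampTime_of_mem _ ht] at heq
  filter_upwards [heq] with x ⟨hdens, hmom⟩
  rw [hdens] at hmom
  exact ⟨hdens, smul_right_injective _ (h.density_pos t ht x).ne' hmom⟩

end AllTimes

end BarotropicEuler

theorem proposition5p1_general {N : ℕ} {p : ℝ → ℝ} (hp : IsPressure p) {T : ℝ}
    {ρ : ℝ → Space N → ℝ} {u : ℝ → Space N → Space N} (hadm : IsAdmissible p T ρ u)
    (hmax : MaximalDissipation p T ρ u) {τ₁ τ₂ : ℝ} (hτ₁ : 0 ≤ τ₁) (hτ : τ₁ < τ₂) (hτ₂ : τ₂ ≤ T)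
    {r : ℝ → Space N → ℝ} {U : ℝ → Space N → Space N} (hsm : IsSmoothSolution p τ₁ τ₂ r U)
    (hagree : ∀ᵐ x ∂(cellMeasure N), ρ τ₁ x = r τ₁ x ∧ u τ₁ x = U τ₁ x) :
    ∀ t ∈ Icc τ₁ τ₂, ∀ᵐ x ∂(cellMeasure N), ρ t x = r t x ∧ u t x = U t x := by
  obtain ⟨C, ρ', u', hsol, hrep⟩ := hadm.weak.exists_isBoundedSolution hp.continuousOn
  replace hsol := hsol.mono hτ₁ hτ₂
  replace hrep : ∀ t ∈ Icc τ₁ τ₂, ∀ᵐ x ∂(cellMeasure N), ρ' t x = ρ t x ∧ u' t x = u t x :=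
    fun t ht => hrep t ⟨hτ₁.trans ht.1, ht.2.trans hτ₂⟩
  have hinit : ∀ᵐ x ∂(cellMeasure N), ρ' τ₁ x = r τ₁ x ∧ u' τ₁ x = U τ₁ x := by
    filter_upwards [hrep τ₁ (left_mem_Icc.2 hτ.le), hagree] with x hx hx'
      using ⟨hx.1.trans hx'.1, hx.2.trans hx'.2⟩
  have henergy : ∀ᵐ t, t ∈ Ioo τ₁ τ₂ → totalEnergy p ρ' u' t ≤ totalEnergy p r U τ₁ := by
    filter_upwards [hadm.ae_totalEnergy_le_smooth hp hmax hsm hτ₁ hτ hτ₂ hagree] with t hE ht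
    rw [totalEnergy_congr (hrep t (Ioo_subset_Icc_self ht))]
    exact hE ⟨ht.1, ht.2.trans_le hτ₂⟩
  have hae := hsm.ae_eq_of_totalEnergy_le hp hsol hτ.le hinit henergy
  intro t ht
  filter_upwards [hsm.ae_eq_of_ae_ae_eq hp hsol hτ.le hinit hae ht, hrep t ht] with x hx hx'
  exact ⟨hx'.1.symm.trans hx.1, hx'.2.symm.trans hx.2⟩

theorem proposition5p1 (N : ℕ) (hN : N = 2 ∨ N = 3) (p : ℝ → ℝ) (hp : IsPressure p)
    (T : ℝ) (ρ : ℝ → Space N → ℝ) (u : ℝ → Space N → Space N)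
    (hadm : IsAdmissible p T ρ u) (hmax : MaximalDissipation p T ρ u)
    (τ₁ τ₂ : ℝ) (hτ₁ : 0 ≤ τ₁) (hτ : τ₁ < τ₂) (hτ₂ : τ₂ ≤ T)
    (r : ℝ → Space N → ℝ) (U : ℝ → Space N → Space N) (hsm : IsSmoothSolution p τ₁ τ₂ r U)
    (hagree : ∀ᵐ x ∂(cellMeasure N), ρ τ₁ x = r τ₁ x ∧ u τ₁ x = U τ₁ x) :
    ∀ t ∈ Set.Icc τ₁ τ₂, ∀ᵐ x ∂(cellMeasure N), ρ t x = r t x ∧ u t x = U t x :=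
  proposition5p1_general hp hadm hmax hτ₁ hτ hτ₂ hsm hagree
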